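/- There are absolute constants $C>0$ and $m\in\mathbb N$ such that the following holds for every $d$, every horizon $T\ge 3$, every $k\ge 0$, all parameters $\epsilon,c,\gamma_\alpha,\gamma_\beta,\tau_G,\tau_D>0$, and every $G$. **Setting.** In round $t=1,\dots,T$ the learner plays $w_t\in\mathbb R^d$ and then receives a vector $\tilde g_t$, a corrupted version of the true gradient $g_t$. The bound $G\ge\max_t\|g_t\|$ exists but is unknown to the learner. The corruption is $k$-bounded: the set $\mathcal B=\{t:\|g_t-\tilde g_t\|>G\}$ satisfies $|\mathcal B|\le k$, and $\sum_{t\notin\mathcal B}\|g_t-\tilde g_t\|\le kG$. Otherwise $g_t,\tilde g_t$ are arbitrary (for instance adversarial). Put $[G]=\max(\tau_G,G)$. **Algorithm.** Let $p=\ln T$, $\alpha=\epsilon\tau_G/c$, $\gamma=\gamma_\alpha+\gamma_\beta$. In round $t$: 1. *(Filter.)* A threshold $h_t$ starts at $h_1=\tau_G$. It doubles as soon as more than $k$ rounds (that is, $k+1$ rounds for integral $k$) with $\|\tilde g_t\|\ge h_t$ have been observed at its current value, and is constant otherwise. The clipped gradient is $\tilde g_t^c=\min(1,h_t/\|\tilde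 g_t\|)\,\tilde g_t$. 2. *(Tracker.)* A level $z_t$ starts at $z_1=\tau_D$; $z_{t+1}=2\|w_t\|$ if $\|w_t\|\ge z_t$, and $z_{t+1}=z_t$ otherwise. 3. *(Regularizer.)* $r_t(w)=f_t(w)+a_t\|w\|^2$ with $a_t=\alpha_t+\beta_t$, $\alpha_t=\gamma_\alpha\mathbf 1\{h_{t+1}\ne h_t\}$, $\beta_t=\gamma_\beta\,\dfrac{\mathbf 1\{z_{t+1}\neq z_t\}}{1+\sum_{i\le t}\mathbf 1\{z_{i+1}\ne z_i\}}$, and the Huber regularizer, with $S_t=\alpha^p+\sum_{i\le t}\|w_i\|^p$, $$f_t(w)=\begin{cases}c\,\|w\|^p\,S_t^{-(1-1/p)},&\|w\|\le\|w_t\|,\\ c\,\big(p\|w\|-(p-1)\|w_t\|\big)\,\|w_t\|^{p-1}\,S_t^{-(1-1/p)},&\|w\|>\|w_t\|.\end{cases}$$ 4. *(Base algorithm.)* The loss $\langle\tilde g_t^c,w\rangle+f_t(w)+a_t\|w\|^2$ is given to the following epigraph-based learner, which is told $h_t$ before it predicts. It works in $\mathbb R^{d}\times\mathbb R$ with the norm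 $\|(w,y)\|_t=\sqrt{h_t^2\|w\|^2+\gamma^2y^2}$. It forms a point $(x_t,y_t)$, projects it in this norm to $(w_t,\hat y_t)$ in the epigraph $\{(w,y):y\ge\|w\|^2\}$, and plays $w_t$. With $D_t=\|(x_t-w_t,y_t-\hat y_t)\|_t$, $\rho_t=\sqrt{\|\tilde g_t^c\|^2/h_t^2+a_t^2/\gamma^2}$, and the convention $1/0=0$, it then sets $$v_t=\tilde g_t^c+\nabla f_t(w_t)+\tfrac{\rho_th_t^2}{D_t}(x_t-w_t),\qquad b_t=a_t+\tfrac{\rho_t\gamma^2}{D_t}(y_t-\hat y_t).$$ Here $x_t=m_t\theta_t$, where * $\theta_t$ is projected gradient descent in the unit ball: $\theta_1=0$, and $\theta_{t+1}$ is the projection of $\theta_t-v_t/\sqrt{\sum_{i\le t}\|v_i\|^2}$ to the unit ball; * $m_t$ is the output of a coin-betting learner on the slopes $\langle v_t,\theta_t\rangle$ with hints $B_t=3h_t+cp$; * $y_t$ is the output of a coin-betting learner on the slopes $b_t$ with hints $B_t=3\gamma$. A coin-betting learner on slopes $\sigma_t$ with hints $B_t$ has wealth $W_1=\epsilon\tau_G$,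 $A_1=B_1^2$ and $\nu_1=0$. It outputs $q_tW_t$, where $q_t$ is $\nu_t$ clipped to $[-\frac1{2B_t},\frac1{2B_t}]$, and updates $W_{t+1}=W_t(1-\sigma_tq_t)$, $\zeta_t=\sigma_t/(1-\sigma_tq_t)$, $A_{t+1}=A_t+\zeta_t^2$, $\nu_{t+1}=q_t-\frac52\,\zeta_t/A_{t+1}$. **Claim.** For every $u\in\mathbb R^d$, $$\sum_{t=1}^T\langle g_t,w_t-u\rangle\le C\,L^m\Big[\epsilon[G]+k\tau_D[G]+\|u\|[G](\sqrt T+k)+c(\|u\|+\tau_D)+(\gamma_\alpha(k+1)+\gamma_\beta)\|u\|^2+\frac{(k+1)[G]^2}{\gamma_\alpha}+\frac{k^2[G]^2}{\gamma_\beta}\Big],$$ where $$L=\ln\Big(e+T+k+\tfrac{[G]}{\tau_G}+\tfrac{\|u\|}{\epsilon}+\tfrac{c}{\tau_G}+\tfrac{\tau_G}{c}+\tfrac{\tau_D}{\epsilon}+\tfrac{\epsilon}{\tau_D}+\tfrac{\gamma_\alpha\epsilon}{\tau_G}+\tfrac{\tau_G}{\gamma_\alpha\epsilon}+\tfrac{\gamma_\beta\epsilon}{\tau_G}+\tfrac{\tau_G}{\gamma_\beta\epsilon}\Big).$$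 Consequently, if $g_t$ is a subgradient at $w_t$ of a loss $\ell_t:\mathbb R^d\to\mathbb R$ for each $t$, then the regret $R_T(u)=\sum_{t=1}^T(\ell_t(w_t)-\ell_t(u))$ satisfies the same bound. -/

import Mathlib

noncomputable section

namespace RobustOCO

/-- The decision space `ℝ^d` with the Euclidean norm. -/
abbrev Vec (d : ℕ) : Type := EuclideanSpace ℝ (Fin d)

/-- Inputs of the method: horizon `T`, corruption level `k`, and the free parameters. -/
structure Params where
  T : ℕ
  k : ℝ
  ε : ℝ
  c : ℝ
  γα : ℝ
  γβ : ℝ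
  τG : ℝ
  τD : ℝ

/-- The exponent `p = ln T` of the Huber regularizer. -/
def Params.p (P : Params) : ℝ := Real.log P.T

/-- The offset `α = ε τ_G / c` of the Huber regularizer. -/
def Params.α (P : Params) : ℝ := P.ε * P.τG / P.c

/-- The upper bound `γ = γ_α + γ_β` for the quadratic weights. -/
def Params.γ (P : Params) : ℝ := P.γα + P.γβ

/-! ### Corruption model and regret

Rounds are numbered `0, …, T - 1`. -/

/-- The rounds whose corruption exceeds `G`. -/
def bigRounds {d : ℕ} (T : ℕ) (G : ℝ) (g gt : ℕ → Vec d) : Finset ℕ :=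
  (Finset.range T).filter fun t => G < ‖g t - gt t‖

/-- `k`-bounded corruption: at most `k` rounds have corruption larger than `G`,
and the corruptions of all other rounds add up to at most `k G`. -/
def CorruptionBounded {d : ℕ} (T : ℕ) (k G : ℝ) (g gt : ℕ → Vec d) : Prop :=
  ((bigRounds T G g gt).card : ℝ) ≤ k ∧
    ∑ t ∈ Finset.range T \ bigRounds T G g gt, ‖g t - gt t‖ ≤ k * G

/-- `v` is a subgradient of `f` at `w`. -/
def IsSubgradient {d : ℕ} (f : Vec d → ℝ) (w v : Vec d) : Prop :=
  ∀ x, f w + inner ℝ v (x - w) ≤ f x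

/-- Regret of the plays `w` for the losses `ℓ`. -/
def regret {d : ℕ} (T : ℕ) (ℓ : ℕ → Vec d → ℝ) (w : ℕ → Vec d) (u : Vec d) : ℝ :=
  ∑ t ∈ Finset.range T, (ℓ t (w t) - ℓ t u)

/-- Linearized regret `∑ ⟨g_t, w_t - u⟩`. -/
def linRegret {d : ℕ} (T : ℕ) (g w : ℕ → Vec d) (u : Vec d) : ℝ :=
  ∑ t ∈ Finset.range T, inner ℝ (g t) (w t - u)

/-! ### Filter, tracker and regularizer -/

/-- State of the filter: the threshold `h` and the number `n` of rounds with
`h ≤ ‖gt‖` that were observed since `h` last changed. -/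
structure FilterState where
  h : ℝ
  n : ℕ

/-- The threshold doubles at the first moment when more than `k` rounds (that is, `k + 1` rounds
for integral `k`) with `h ≤ ‖gt‖` have been observed at the current threshold. -/
def filterStep {d : ℕ} (k : ℝ) (s : FilterState) (gt : Vec d) : FilterState :=
  if s.h ≤ ‖gt‖ then
    if k < (s.n : ℝ) + 1 then ⟨2 * s.h, 0⟩ else ⟨s.h, s.n + 1⟩
  else s

/-- Clipping of a gradient to norm at most `h`. -/
def clip {d : ℕ} (h : ℝ) (gt : Vec d) : Vec d := min 1 (h / ‖gt‖) • gt

/-- State of the tracker: the level `z` and the number `m` of changes of `z` so far. -/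
structure TrackerState where
  z : ℝ
  m : ℕ

/-- `z` becomes `2 ‖w‖` whenever `‖w‖ ≥ z`. -/
def trackerStep {d : ℕ} (s : TrackerState) (w : Vec d) : TrackerState :=
  if s.z ≤ ‖w‖ then ⟨2 * ‖w‖, s.m + 1⟩ else s

/-- `α_t = γ_α 1{h_{t+1} ≠ h_t}`. -/
def alphaWeight (γα : ℝ) (s s' : FilterState) : ℝ := if s'.h ≠ s.h then γα else 0

/-- `β_t = γ_β 1{z_{t+1} ≠ z_t} / (1 + ∑_{i ≤ t} 1{z_{i+1} ≠ z_i})`. -/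
def betaWeight (γβ : ℝ) (s s' : TrackerState) : ℝ :=
  if s'.z ≠ s.z then γβ / (1 + (s'.m : ℝ)) else 0

/-- The Huber regularizer `f_t`, where `wt` is the current play and `S = ∑_{i ≤ t} ‖w_i‖ ^ p`. -/
def huber {d : ℕ} (c p α S : ℝ) (wt w : Vec d) : ℝ :=
  if ‖w‖ ≤ ‖wt‖ then
    c * ‖w‖ ^ p / (S + α ^ p) ^ (1 - 1 / p)
  else
    c * (p * ‖w‖ - (p - 1) * ‖wt‖) * ‖wt‖ ^ (p - 1) / (S + α ^ p) ^ (1 - 1 / p)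

/-! ### The general algorithm -/

/-- An online learner for composite losses `w ↦ ⟨gc, w⟩ + f w + a ‖w‖ ^ 2`.
Before it predicts, it is told a bound `h` for `‖gc‖`; after it predicted, it is told `gc`, the
function `f` and the weight `a`. -/
structure BaseAlgorithm (d : ℕ) where
  State : Type
  init : State
  predict : State → ℝ → Vec d
  update : State → ℝ → Vec d → (Vec d → ℝ) → ℝ → State

/-- State of the general algorithm at the beginning of a round; `S` is the sum of
`‖w_i‖ ^ p` over the previous rounds. -/
structure AlgState {d : ℕ} (A : BaseAlgorithm d) where
  base : A.State
  filter : FilterState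
  tracker : TrackerState
  S : ℝ

/-- One round of the general algorithm, on the received gradient `gt`: clip it at the filter's
threshold, compute the regularizer `r_t = f_t + a_t ‖·‖ ^ 2` with `a_t = α_t + β_t`,
and hand the regularized loss to the base algorithm. -/
def algStep {d : ℕ} (P : Params) (A : BaseAlgorithm d) (s : AlgState A) (gt : Vec d) :
    AlgState A :=
  let w := A.predict s.base s.filter.h
  let F := filterStep P.k s.filter gt
  let K := trackerStep s.tracker w
  let S := s.S + ‖w‖ ^ P.p
  let a := alphaWeight P.γα s.filter F + betaWeight P.γβ s.tracker K
  { base := A.update s.base s.filter.h (clip s.filter.h gt) (huber P.c P.p P.α S w) a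
    filter := F
    tracker := K
    S := S }

/-- State before round `t` of the general algorithm, run on the received gradients `gt`. -/
def algState {d : ℕ} (P : Params) (A : BaseAlgorithm d) (gt : ℕ → Vec d) : ℕ → AlgState A
  | 0 => { base := A.init, filter := ⟨P.τG, 0⟩, tracker := ⟨P.τD, 0⟩, S := 0 }
  | t + 1 => algStep P A (algState P A gt t) (gt t)

/-- The play `w_t` of the general algorithm. -/
def play {d : ℕ} (P : Params) (A : BaseAlgorithm d) (gt : ℕ → Vec d) (t : ℕ) : Vec d :=
  A.predict (algState P A gt t).base (algState P A gt t).filter.h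

/-! ### Parameter-free learners on the line and on `ℝ^d` -/

/-- State of a one-dimensional coin-betting learner whose betting fraction is chosen by an online
Newton step: wealth, unclipped betting fraction, and accumulated squared derivatives. -/
structure CoinState where
  wealth : ℝ
  raw : ℝ
  A : ℝ

/-- The betting fraction, for a bound `b` on the next loss slope. -/
def CoinState.frac (s : CoinState) (b : ℝ) : ℝ := max (-(1 / (2 * b))) (min (1 / (2 * b)) s.raw)

/-- The prediction of the coin-betting learner. -/
def CoinState.bet (s : CoinState) (b : ℝ) : ℝ := s.frac b * s.wealth

/-- Update of the coin-betting learner on the loss slope `σ`, `|σ| ≤ b`. -/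
def CoinState.step (s : CoinState) (b σ : ℝ) : CoinState :=
  let v := s.frac b
  let ζ := σ / (1 - σ * v)
  { wealth := s.wealth * (1 - σ * v)
    raw := v - 5 / 2 * (ζ / (s.A + ζ ^ 2))
    A := s.A + ζ ^ 2 }

/-- State of adaptive projected gradient descent on the unit ball: current point and
accumulated squared gradient norms. -/
structure DirState (d : ℕ) where
  dir : Vec d
  Q : ℝ

/-- Gradient step with step size `1 / √Q`, then projection to the unit ball. -/
def DirState.step {d : ℕ} (s : DirState d) (v : Vec d) : DirState d :=
  let Q := s.Q + ‖v‖ ^ 2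
  let y := s.dir - (1 / √Q) • v
  { dir := (1 / max 1 ‖y‖) • y
    Q := Q }

/-! ### The epigraph-based base algorithm -/

/-- The epigraph of `w ↦ ‖w‖ ^ 2` in the augmented space. -/
def epigraph (d : ℕ) : Set (Vec d × ℝ) := {q | ‖q.1‖ ^ 2 ≤ q.2}

/-- The norm `√(h ^ 2 ‖w‖ ^ 2 + γ ^ 2 y ^ 2)` on the augmented space. -/
def augNorm {d : ℕ} (h γ : ℝ) (q : Vec d × ℝ) : ℝ := √(h ^ 2 * ‖q.1‖ ^ 2 + γ ^ 2 * q.2 ^ 2)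

/-- `r` is a nearest point to `q` in the epigraph, for `augNorm h γ`. -/
def IsEpiProj {d : ℕ} (h γ : ℝ) (q r : Vec d × ℝ) : Prop :=
  r ∈ epigraph d ∧ ∀ r' ∈ epigraph d, augNorm h γ (q - r) ≤ augNorm h γ (q - r')

theorem exists_isEpiProj {d : ℕ} {h γ : ℝ} (hh : 0 < h) (hγ : 0 < γ) (q : Vec d × ℝ) :
    ∃ r, IsEpiProj h γ q r := by
  have hcont : Continuous fun r : Vec d × ℝ => augNorm h γ (q - r) := by
    unfold augNorm
    fun_prop
  have hclosed : IsClosed (epigraph d) :=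
    isClosed_le (by fun_prop) (by fun_prop)
  have hμ : 0 < min h γ := lt_min hh hγ
  have hlow : ∀ r : Vec d × ℝ, min h γ * (‖r‖ - ‖q‖) ≤ augNorm h γ (q - r) := by
    intro r
    have h1 : min h γ * (‖r‖ - ‖q‖) ≤ min h γ * ‖q - r‖ := by
      refine mul_le_mul_of_nonneg_left ?_ hμ.le
      rw [norm_sub_rev]
      exact norm_sub_norm_le r q
    refine h1.trans (Real.le_sqrt_of_sq_le ?_)
    set v := q - r
    have e1 : min h γ ^ 2 ≤ h ^ 2 := pow_le_pow_left₀ hμ.le (min_le_left _ _) 2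
    have e2 : min h γ ^ 2 ≤ γ ^ 2 := pow_le_pow_left₀ hμ.le (min_le_right _ _) 2
    have e3 : ‖v‖ ^ 2 ≤ ‖v.1‖ ^ 2 + v.2 ^ 2 := by
      rw [Prod.norm_def, Real.norm_eq_abs]
      rcases max_cases ‖v.1‖ |v.2| with ⟨e, -⟩ | ⟨e, -⟩ <;> rw [e]
      · nlinarith [sq_nonneg v.2]
      · rw [sq_abs]
        nlinarith [sq_nonneg ‖v.1‖]
    rw [mul_pow]
    nlinarith [mul_le_mul_of_nonneg_left e3 (sq_nonneg (min h γ)),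
      mul_le_mul_of_nonneg_right e1 (sq_nonneg ‖v.1‖),
      mul_le_mul_of_nonneg_right e2 (sq_nonneg v.2)]
  have htend : Filter.Tendsto (fun r : Vec d × ℝ => augNorm h γ (q - r))
      (Filter.cocompact _) Filter.atTop := by
    refine Filter.tendsto_atTop_mono hlow ?_
    exact (Filter.tendsto_atTop_add_const_right _ (-‖q‖)
      (tendsto_norm_cocompact_atTop (E := Vec d × ℝ))).const_mul_atTop hμ
  have h0 : (0 : Vec d × ℝ) ∈ epigraph d := by simp [epigraph]
  obtain ⟨r, hr, hmin⟩ := hcont.continuousOn.exists_isMinOn' hclosed h0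
    ((htend.eventually_ge_atTop _).filter_mono inf_le_left)
  exact ⟨r, hr, fun r' hr' => hmin hr'⟩

/-- Projection to the epigraph. -/
def epiProj {d : ℕ} (h γ : ℝ) (q : Vec d × ℝ) : Vec d × ℝ :=
  Classical.epsilon fun r => IsEpiProj h γ q r

theorem isEpiProj_epiProj {d : ℕ} {h γ : ℝ} (hh : 0 < h) (hγ : 0 < γ) (q : Vec d × ℝ) :
    IsEpiProj h γ q (epiProj h γ q) :=
  Classical.epsilon_spec (exists_isEpiProj hh hγ q)

/-- State of the base algorithm: magnitude and direction learners for the first `d` coordinates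
of the augmented space, and a coin-betting learner for the extra coordinate. -/
structure EpiState (d : ℕ) where
  mag : CoinState
  dir : DirState d
  extra : CoinState

/-- Bound for the slopes seen by the learner of the first `d` coordinates. -/
def slopeBound (P : Params) (h : ℝ) : ℝ := 3 * h + P.c * P.p

/-- The unprojected point `(x_t, y_t)` of the augmented space. -/
def EpiState.point {d : ℕ} (P : Params) (s : EpiState d) (h : ℝ) : Vec d × ℝ :=
  (s.mag.bet (slopeBound P h) • s.dir.dir, s.extra.bet (3 * P.γ))

/-- Update on the loss `w ↦ ⟨gc, w⟩ + f w + a ‖w‖ ^ 2`. In the augmented space, its quadratic part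
is the linear loss `a y`. To the slopes `(gc + ∇f (w_t), a)` the update adds the gradient at
`(x_t, y_t)` of the distance to the epigraph, multiplied by the dual norm of `(gc, a)`, and feeds
the sums to the learners of the coordinates. -/
def EpiState.step {d : ℕ} (P : Params) (s : EpiState d) (h : ℝ) (gc : Vec d) (f : Vec d → ℝ)
    (a : ℝ) : EpiState d :=
  let q := s.point P h
  let r := epiProj h P.γ q
  let ρ := √(‖gc‖ ^ 2 / h ^ 2 + a ^ 2 / P.γ ^ 2)
  let D := augNorm h P.γ (q - r)
  let v : Vec d := gc + gradient f r.1 + (ρ * h ^ 2 / D) • (q.1 - r.1)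
  let b : ℝ := a + ρ * P.γ ^ 2 / D * (q.2 - r.2)
  { mag := s.mag.step (slopeBound P h) (inner ℝ v s.dir.dir)
    dir := s.dir.step v
    extra := s.extra.step (3 * P.γ) b }

/-- The epigraph-based base algorithm. Both betting learners start with wealth `ε τ_G`. -/
def epigraphAlgorithm (d : ℕ) (P : Params) : BaseAlgorithm d where
  State := EpiState d
  init :=
    { mag := ⟨P.ε * P.τG, 0, slopeBound P P.τG ^ 2⟩
      dir := ⟨0, 0⟩
      extra := ⟨P.ε * P.τG, 0, (3 * P.γ) ^ 2⟩ }
  predict s h := (epiProj h P.γ (s.point P h)).1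
  update s h gc f a := s.step P h gc f a

/-! ### The regret bound -/

/-- `[G] = max(τ_G, G)`. -/
def Params.capG (P : Params) (G : ℝ) : ℝ := max P.τG G

/-- The logarithm whose powers are hidden by the notation `Õ`: it involves `T`, `k` and the
scale-free ratios of the parameters. -/
def logFactor {d : ℕ} (P : Params) (G : ℝ) (u : Vec d) : ℝ :=
  Real.log (Real.exp 1 + P.T + P.k + P.capG G / P.τG + ‖u‖ / P.ε
    + P.c / P.τG + P.τG / P.c + P.τD / P.ε + P.ε / P.τD
    + P.γα * P.ε / P.τG + P.τG / (P.γα * P.ε)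
    + P.γβ * P.ε / P.τG + P.τG / (P.γβ * P.ε))

/-- The expression inside `Õ`. -/
def rate {d : ℕ} (P : Params) (G : ℝ) (u : Vec d) : ℝ :=
  P.ε * P.capG G + P.k * P.τD * P.capG G + ‖u‖ * P.capG G * (√P.T + P.k)
    + P.c * (‖u‖ + P.τD) + (P.γα * (P.k + 1) + P.γβ) * ‖u‖ ^ 2
    + (P.k + 1) * P.capG G ^ 2 / P.γα + P.k ^ 2 * P.capG G ^ 2 / P.γβ

end RobustOCO

end

/-!
The regret against `u` splits into the regret on the clipped gradients and the error
`∑ ⟨g_t - clip g̃_t, w_t - u⟩` of clipping and corruption.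

*Clipped gradients.* In the augmented space the quadratic weight is the linear loss `a_t y`, and
`(u, ‖u‖²)` is a comparator in the epigraph. Correcting the slopes by the gradient of the distance
to the epigraph makes the projection free of charge (`IsEpiProj.regret_le`), so that the coordinates
can be learned separately: the first `d` by gradient descent on the unit ball for the direction
(`dir_regret`) and coin betting for the magnitude (`coin_regret`), which costs
`‖u‖ √(∑ ‖v_t‖²)` up to logarithms; the extra one by coin betting. There the slopes are `a_t - n_t`
with `n_t ≥ 0`, and their squares are linear in `a_t` and `n_t`, so the second-order bound bounds
itself and leaves `‖u‖² (γ + ∑ a_t)` instead of `‖u‖² γ √T` (`extra_regret`). The sum `∑ a_t` is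
logarithmic, since the threshold doubles at most logarithmically often and the weights `β_t` are
harmonic.

*Clipping and corruption.* A threshold is left only after more than `k` rounds reached it, one of
which has a small corruption; hence thresholds stay below `4 [G]` (`filter_h_le`). The rounds that
change the threshold are paid for by `α_t ‖w_t‖²`. The other errors add up to a multiple of `k [G]`
times the largest play (`exists_clip_error`), which is at most twice the play at the last change
of the tracker and is paid for by `β_t ‖w_t‖²` in that round (`mul_tracker_le`).

*The size of the plays.* It enters both parts through its logarithm: in `∑ ‖∇f_t(w_t)‖²` and
`∑ f_t(u)`, where `T ^ (1 / p) = e` turns the sums of the ratios `‖w_t‖ ^ p / S_t` into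
`log (N / α)`, with `N` the `ℓ^p` norm of the norms of the plays and of `α`; and in the number of
changes of the tracker. The Huber regularizer contributes `-c (N - α)` and absorbs both logarithms
(`mul_log_le_absorb`); what remains are logarithms of ratios of the parameters.
-/

noncomputable section

namespace RobustOCO

/-! ### Coin betting -/

/-- Exponential concavity: `[-2/3, 2]` is the range of `(1 - a) / (1 - b) - 1` for
`|a|, |b| ≤ 1/2`, and the constant `1/5` is the one that fits the step size `5/2` of the
Newton step. -/
theorem log_one_add_le_sub_sq {x : ℝ} (h1 : -(2 / 3) ≤ x) (h2 : x ≤ 2) :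
    Real.log (1 + x) ≤ x - x ^ 2 / 5 := by
  have hder : ∀ y : ℝ, -(2/3) ≤ y → HasDerivAt (fun y => y - y ^ 2 / 5 - Real.log (1 + y))
      (y * (3 - 2 * y) / (5 * (1 + y))) y := by
    intro y hy
    have h0 : (1 + y) ≠ 0 := by linarith
    have h3 := (((hasDerivAt_id y).sub (((hasDerivAt_id y).pow 2).div_const 5)).sub
      (((hasDerivAt_id y).const_add 1).log h0))
    refine h3.congr_deriv ?_
    simp only [id]
    field_simp
    ring
  set F : ℝ → ℝ := fun y => y - y ^ 2 / 5 - Real.log (1 + y) with hF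
  have hF0 : F 0 = 0 := by simp [hF]
  have hcont : ∀ a b : ℝ, -(2/3) ≤ a → ContinuousOn F (Set.Icc a b) := fun a b ha y hy =>
    (hder y (ha.trans hy.1)).continuousAt.continuousWithinAt
  suffices 0 ≤ F x by simp only [hF] at this; linarith
  rcases le_total x 0 with hx | hx
  · have hanti : AntitoneOn F (Set.Icc (-(2/3)) 0) := by
      refine antitoneOn_of_deriv_nonpos (convex_Icc _ _) (hcont _ _ le_rfl) ?_ ?_
      · intro y hy
        rw [interior_Icc] at hy
        exact (hder y hy.1.le).differentiableAt.differentiableWithinAt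
      · intro y hy
        rw [interior_Icc] at hy
        rw [(hder y hy.1.le).deriv]
        refine div_nonpos_of_nonpos_of_nonneg ?_ ?_ <;> nlinarith [hy.1, hy.2]
    rw [← hF0]
    exact hanti ⟨h1, hx⟩ ⟨by norm_num, le_rfl⟩ hx
  rcases le_total x (3/2) with hx' | hx'
  · have hmono : MonotoneOn F (Set.Icc 0 (3/2)) := by
      refine monotoneOn_of_deriv_nonneg (convex_Icc _ _) (hcont _ _ (by norm_num)) ?_ ?_
      · intro y hy
        rw [interior_Icc] at hy
        exact (hder y (by linarith [hy.1])).differentiableAt.differentiableWithinAt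
      · intro y hy
        rw [interior_Icc] at hy
        rw [(hder y (by linarith [hy.1])).deriv]
        refine div_nonneg ?_ ?_ <;> nlinarith [hy.1, hy.2]
    rw [← hF0]
    exact hmono ⟨le_rfl, by norm_num⟩ ⟨hx, hx'⟩ hx
  · have hanti : AntitoneOn F (Set.Icc (3/2) 2) := by
      refine antitoneOn_of_deriv_nonpos (convex_Icc _ _) (hcont _ _ (by norm_num)) ?_ ?_
      · intro y hy
        rw [interior_Icc] at hy
        exact (hder y (by linarith [hy.1])).differentiableAt.differentiableWithinAt
      · intro y hy
        rw [interior_Icc] at hy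
        rw [(hder y (by linarith [hy.1])).deriv]
        refine div_nonpos_of_nonpos_of_nonneg ?_ ?_ <;> nlinarith [hy.1, hy.2]
    have hF2 : 0 ≤ F 2 := by
      have he : (3 : ℝ) ≤ Real.exp (6/5) := by
        have h1 := Real.quadratic_le_exp_of_nonneg (x := 3/5) (by norm_num)
        have h2 : Real.exp (6/5) = Real.exp (3/5) ^ 2 := by
          rw [← Real.exp_nat_mul]; norm_num
        rw [h2]; nlinarith
      have := (Real.log_le_iff_le_exp (by norm_num : (0:ℝ) < 3)).2 he
      simp only [hF]
      norm_num
      linarith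
    exact hF2.trans (hanti ⟨hx', h2⟩ ⟨by norm_num, le_rfl⟩ h2)

theorem neg_sub_sq_le_log_one_sub {x : ℝ} (hx : |x| ≤ 1 / 2) :
    -x - x ^ 2 ≤ Real.log (1 - x) := by
  obtain ⟨h1, h2⟩ := abs_le.1 hx
  have hpos : 0 < 1 - x := by linarith
  rcases le_total x 0 with h0 | h0
  · refine le_trans ?_ (Real.one_sub_inv_le_log_of_pos hpos)
    have : 1 - (1 - x)⁻¹ - (-x - x ^ 2) = -x ^ 3 / (1 - x) := by field_simp; ring
    have h3 : 0 ≤ -x ^ 3 / (1 - x) := by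
      refine div_nonneg ?_ hpos.le
      nlinarith [mul_nonneg_of_nonpos_of_nonpos h0 h0, sq_nonneg x]
    linarith
  · rw [Real.le_log_iff_exp_le hpos]
    have hq := Real.quadratic_le_exp_of_nonneg (x := x + x ^ 2) (by positivity)
    have he : Real.exp (-x - x ^ 2) = (Real.exp (x + x ^ 2))⁻¹ := by
      rw [← Real.exp_neg]; ring_nf
    rw [he, inv_le_comm₀ (Real.exp_pos _) hpos]
    refine le_trans ?_ hq
    rw [inv_le_iff_one_le_mul₀ hpos]
    have : 0 ≤ 1 - x - x ^ 2 - x ^ 3 := by nlinarith [sq_nonneg x]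
    nlinarith [mul_nonneg (sq_nonneg x) this]

theorem abs_clamp_le {b r : ℝ} (hb : 0 ≤ b) : |max (-b) (min b r)| ≤ b := by
  rw [abs_le]
  exact ⟨le_max_left _ _, max_le (by linarith) (min_le_left _ _)⟩

theorem sq_clamp_sub_le {b r q : ℝ} (hq : |q| ≤ b) :
    (max (-b) (min b r) - q) ^ 2 ≤ (r - q) ^ 2 := by
  obtain ⟨h1, h2⟩ := abs_le.1 hq
  rw [sq_le_sq]
  rcases le_total r b with hr | hr
  · rw [min_eq_right hr]
    rcases le_total (-b) r with hr' | hr'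
    · rw [max_eq_right hr']
    · rw [max_eq_left hr', abs_of_nonpos (by linarith), abs_of_nonpos (by linarith)]
      linarith
  · rw [min_eq_left hr, max_eq_right (by linarith), abs_of_nonneg (by linarith),
      abs_of_nonneg (by linarith)]
    linarith

theorem abs_mul_frac_le {s : CoinState} {b σ : ℝ} (hb : 0 < b) (hσ : |σ| ≤ b) :
    |σ * s.frac b| ≤ 1 / 2 := by
  have h1 : |s.frac b| ≤ 1 / (2 * b) := abs_clamp_le (by positivity)
  rw [abs_mul]
  calc |σ| * |s.frac b| ≤ b * (1 / (2 * b)) := by gcongr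
    _ = 1 / 2 := by field_simp

theorem coinState_A_pos {s : ℕ → CoinState} {B σ : ℕ → ℝ} (hA : 0 < (s 0).A)
    (hs : ∀ t, s (t + 1) = (s t).step (B t) (σ t)) (t : ℕ) : 0 < (s t).A := by
  induction t with
  | zero => exact hA
  | succ t ih => rw [hs]; simp only [CoinState.step]; positivity

theorem coinState_wealth_pos {s : ℕ → CoinState} {B σ : ℕ → ℝ} (hW : 0 < (s 0).wealth)
    (hB : ∀ t, 0 < B t) (hσ : ∀ t, |σ t| ≤ B t)
    (hs : ∀ t, s (t + 1) = (s t).step (B t) (σ t)) (t : ℕ) : 0 < (s t).wealth := by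
  induction t with
  | zero => exact hW
  | succ t ih =>
    rw [hs]
    simp only [CoinState.step]
    have := (abs_le.1 (abs_mul_frac_le (s := s t) (hB t) (hσ t))).2
    exact mul_pos ih (by linarith)

/-- One online Newton step on `q ↦ -log (1 - σ q)`, in the metric `A`: the regret against `q` is
paid for by the decrease of the potential `A (raw - q) ^ 2` and the growth of `log A`. -/
theorem newton_step_log_le {s : CoinState} {b σ q : ℝ} (hb : 0 < b) (hσ : |σ| ≤ b)
    (hA : 0 < s.A) (hq : |q| ≤ 1 / (2 * b)) :
    Real.log (1 - σ * q) ≤ Real.log (1 - σ * s.frac b)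
      + (s.A * (s.raw - q) ^ 2 - (s.step b σ).A * ((s.step b σ).raw - q) ^ 2) / 5
      + 5 / 4 * (Real.log (s.step b σ).A - Real.log s.A) := by
  have hv := abs_le.1 (abs_mul_frac_le (s := s) hb hσ)
  have hq' : |σ * q| ≤ 1 / 2 := by
    rw [abs_mul]
    calc |σ| * |q| ≤ b * (1 / (2 * b)) := by gcongr
      _ = 1 / 2 := by field_simp
  replace hq' := abs_le.1 hq'
  have hcl : (s.frac b - q) ^ 2 ≤ (s.raw - q) ^ 2 := sq_clamp_sub_le hq
  simp only [CoinState.step]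
  set v := s.frac b
  have hd : 0 < 1 - σ * v := by linarith
  set ζ := σ / (1 - σ * v) with hζ
  -- `1 + x` is the ratio of the growth factors for `q` and for the fraction `v` that is played
  set x := ζ * (v - q) with hx
  have hx1 : 1 + x = (1 - σ * q) / (1 - σ * v) := by
    rw [hx, hζ]; field_simp; ring
  have hlog : Real.log (1 - σ * q) = Real.log (1 - σ * v) + Real.log (1 + x) := by
    rw [hx1, Real.log_div (by linarith) hd.ne']; ring
  have hxl : Real.log (1 + x) ≤ x - x ^ 2 / 5 := by
    apply log_one_add_le_sub_sq
    · have : 1 / 3 ≤ 1 + x := by rw [hx1, le_div_iff₀ hd]; linarith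
      linarith
    · have : 1 + x ≤ 3 := by rw [hx1, div_le_iff₀ hd]; linarith
      linarith
  have hA' : 0 < s.A + ζ ^ 2 := by positivity
  have hAlog : ζ ^ 2 / (s.A + ζ ^ 2) ≤ Real.log (s.A + ζ ^ 2) - Real.log s.A := by
    rw [← Real.log_div hA'.ne' hA.ne']
    refine le_trans (le_of_eq ?_) (Real.one_sub_inv_le_log_of_pos (by positivity))
    field_simp
    ring
  have hexp : (s.A + ζ ^ 2) * (v - 5 / 2 * (ζ / (s.A + ζ ^ 2)) - q) ^ 2
      = s.A * (v - q) ^ 2 + x ^ 2 - 5 * x + 25 / 4 * (ζ ^ 2 / (s.A + ζ ^ 2)) := by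
    rw [hx]; field_simp; ring
  rw [hlog, hexp]
  nlinarith [mul_le_mul_of_nonneg_left hcl hA.le]

/-- The wealth is, up to a factor polynomial in the growth of `A`, at least that of a constant
betting fraction `q` which is admissible in all rounds. -/
theorem coin_log_wealth {s : ℕ → CoinState} {B σ : ℕ → ℝ} (hW : 0 < (s 0).wealth)
    (hA : 0 < (s 0).A) (hB : ∀ t, 0 < B t) (hσ : ∀ t, |σ t| ≤ B t)
    (hs : ∀ t, s (t + 1) = (s t).step (B t) (σ t)) {T : ℕ} {q : ℝ}
    (hq : ∀ t < T, |q| ≤ 1 / (2 * B t)) :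
    Real.log (s 0).wealth + ∑ t ∈ Finset.range T, Real.log (1 - σ t * q) ≤
      Real.log (s T).wealth
        + ((s 0).A * ((s 0).raw - q) ^ 2 - (s T).A * ((s T).raw - q) ^ 2) / 5
        + 5 / 4 * (Real.log (s T).A - Real.log (s 0).A) := by
  induction T with
  | zero => simp
  | succ T ih =>
    specialize ih fun t ht => hq t (by omega)
    have h1 := newton_step_log_le (hB T) (hσ T) (coinState_A_pos hA hs T) (hq T (by omega))
    rw [Finset.sum_range_succ]
    have h2 : Real.log (s (T + 1)).wealth
        = Real.log (s T).wealth + Real.log (1 - σ T * (s T).frac (B T)) := by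
      rw [hs]
      have := (abs_le.1 (abs_mul_frac_le (s := s T) (hB T) (hσ T))).2
      exact Real.log_mul (coinState_wealth_pos hW hB hσ hs T).ne' (by linarith)
    rw [h2]
    rw [← hs T] at h1
    linarith

theorem coinState_A_le {s : ℕ → CoinState} {B σ : ℕ → ℝ} (hB : ∀ t, 0 < B t)
    (hσ : ∀ t, |σ t| ≤ B t) (hs : ∀ t, s (t + 1) = (s t).step (B t) (σ t)) {T : ℕ} {b : ℝ}
    (hb : ∀ t < T, B t ≤ b) : (s T).A ≤ (s 0).A + 4 * T * b ^ 2 := by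
  induction T with
  | zero => simp
  | succ T ih =>
    specialize ih fun t ht => hb t (by omega)
    rw [hs]
    simp only [CoinState.step]
    have hv := (abs_le.1 (abs_mul_frac_le (s := s T) (hB T) (hσ T))).2
    have h1 : |σ T / (1 - σ T * (s T).frac (B T))| ≤ 2 * b := by
      rw [abs_div, abs_of_pos (by linarith : 0 < 1 - σ T * (s T).frac (B T)),
        div_le_iff₀ (by linarith)]
      have := hb T (by omega)
      have := hσ T
      have := hB T
      nlinarith
    have h2 := sq_le_sq' (abs_le.1 h1).1 (abs_le.1 h1).2
    push_cast
    nlinarith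

/-- The losses of the learner are the wealth it has lost. -/
theorem coin_sum_bet {s : ℕ → CoinState} {B σ : ℕ → ℝ}
    (hs : ∀ t, s (t + 1) = (s t).step (B t) (σ t)) (T : ℕ) :
    ∑ t ∈ Finset.range T, σ t * (s t).bet (B t) = (s 0).wealth - (s T).wealth := by
  induction T with
  | zero => simp
  | succ T ih =>
    rw [Finset.sum_range_succ, ih, hs]
    simp only [CoinState.step, CoinState.bet]
    ring

/-- The bound for `S` that follows from `S q - V q ^ 2 ≤ Λ` at the nearly optimal
`q = √Λ / (√V + 2 b √Λ) ≤ 1 / (2 b)`. -/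
theorem le_of_mul_sub_mul_sq_le {S V Λ b : ℝ} (hb : 0 < b) (hV : 0 ≤ V) (hΛ : 0 < Λ)
    (h : S * (√Λ / (√V + 2 * b * √Λ)) - V * (√Λ / (√V + 2 * b * √Λ)) ^ 2 ≤ Λ) :
    S ≤ 2 * √V * √Λ + 2 * b * Λ := by
  have hl : 0 < √Λ := Real.sqrt_pos.2 hΛ
  have hv : 0 ≤ √V := Real.sqrt_nonneg V
  have e1 : V = √V * √V := (Real.mul_self_sqrt hV).symm
  have e2 : Λ = √Λ * √Λ := (Real.mul_self_sqrt hΛ.le).symm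
  generalize √Λ = l at *
  generalize √V = v at *
  subst e1 e2
  have hden : 0 < v + 2 * b * l := by positivity
  have h1 : S * (v + 2 * b * l) * l ≤ (v ^ 2 + (v + 2 * b * l) ^ 2) * l * l := by
    have e : S * (l / (v + 2 * b * l)) - v * v * (l / (v + 2 * b * l)) ^ 2
        = (S * (v + 2 * b * l) * l - v ^ 2 * l * l) / (v + 2 * b * l) ^ 2 := by
      field_simp
    rw [e, div_le_iff₀ (by positivity)] at h
    linarith
  have h2 : S * (v + 2 * b * l) ≤ (v ^ 2 + (v + 2 * b * l) ^ 2) * l := le_of_mul_le_mul_right h1 hl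
  have h3 : (v ^ 2 + (v + 2 * b * l) ^ 2) * l ≤ (2 * v + 2 * b * l) * l * (v + 2 * b * l) := by
    have : 0 ≤ 2 * (b * l) * v * l := by positivity
    linarith
  have h4 := le_of_mul_le_mul_right (h2.trans h3) hden
  linarith

/-- Regret of the coin-betting learner against `U ≥ 0`. Either it is at most the initial wealth,
or the sum of the slopes is so small that its wealth did not grow. -/
theorem coin_regret {s : ℕ → CoinState} {B σ : ℕ → ℝ} {W : ℝ} (hW : 0 < W)
    (hB : ∀ t, 0 < B t) (hs0 : s 0 = ⟨W, 0, B 0 ^ 2⟩) (hσ : ∀ t, |σ t| ≤ B t)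
    (hs : ∀ t, s (t + 1) = (s t).step (B t) (σ t)) {T : ℕ} {b U Λ : ℝ} (hb0 : 0 < b)
    (hBb : B 0 ≤ b)
    (hb : ∀ t < T, B t ≤ b) (hU : 0 ≤ U)
    (hΛ : 1 + Real.log (1 + U * T * b / W) + 5 / 4 * Real.log (1 + 4 * T * b ^ 2 / B 0 ^ 2) ≤ Λ) :
    ∑ t ∈ Finset.range T, σ t * ((s t).bet (B t) - U) ≤ W ∨
      (∑ t ∈ Finset.range T, σ t * ((s t).bet (B t) - U) ≤ W + U * -∑ t ∈ Finset.range T, σ t ∧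
        -∑ t ∈ Finset.range T, σ t ≤
          2 * √(∑ t ∈ Finset.range T, σ t ^ 2) * √Λ + 2 * b * Λ) := by
  have hW0 : (s 0).wealth = W := by rw [hs0]
  have hA0 : (s 0).A = B 0 ^ 2 := by rw [hs0]
  have hr0 : (s 0).raw = 0 := by rw [hs0]
  have hApos : 0 < (s 0).A := by rw [hA0]; exact pow_pos (hB 0) 2
  have hWT := coinState_wealth_pos (hW0 ▸ hW) hB hσ hs T
  have hsum : ∑ t ∈ Finset.range T, σ t * ((s t).bet (B t) - U)
      = W - (s T).wealth + U * -∑ t ∈ Finset.range T, σ t := by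
    simp only [mul_sub]
    rw [Finset.sum_sub_distrib, coin_sum_bet hs, hW0, ← Finset.sum_mul]
    ring
  set S := -∑ t ∈ Finset.range T, σ t with hS
  set V := ∑ t ∈ Finset.range T, σ t ^ 2 with hV
  have hV0 : 0 ≤ V := Finset.sum_nonneg fun _ _ => sq_nonneg _
  have hT1 : (0:ℝ) ≤ U * T * b / W := by positivity
  have hT2 : (0:ℝ) ≤ 4 * T * b ^ 2 / B 0 ^ 2 := by positivity
  have hl1 := Real.log_nonneg (by linarith : 1 ≤ 1 + U * T * b / W)
  have hl2 := Real.log_nonneg (by linarith : 1 ≤ 1 + 4 * T * b ^ 2 / B 0 ^ 2)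
  have hΛ1 : 1 ≤ Λ := by linarith
  rcases le_or_gt (U * S) (s T).wealth with hc | hc
  · left; rw [hsum]; linarith
  right
  refine ⟨by rw [hsum]; linarith, ?_⟩
  have hUS : 0 < U * S := hWT.trans hc
  have hSb : S ≤ T * b := by
    rw [hS, ← Finset.sum_neg_distrib]
    calc ∑ t ∈ Finset.range T, -σ t ≤ ∑ t ∈ Finset.range T, b := by
          refine Finset.sum_le_sum fun t ht => ?_
          have := hb t (Finset.mem_range.1 ht)
          have := (abs_le.1 (hσ t)).1
          linarith
      _ = T * b := by simp
  -- the optimal betting fraction for sum `S` and quadratic variation `V`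
  set q := √Λ / (√V + 2 * b * √Λ) with hq
  have hΛs : 0 < √Λ := Real.sqrt_pos.2 (by linarith)
  have hden : 0 < √V + 2 * b * √Λ := by positivity
  have hq0 : 0 < q := by positivity
  have hqb : q ≤ 1 / (2 * b) := by
    rw [hq, div_le_div_iff₀ hden (by positivity)]
    nlinarith [Real.sqrt_nonneg V]
  have hqB : ∀ t < T, |q| ≤ 1 / (2 * B t) := by
    intro t ht
    rw [abs_of_pos hq0]
    refine hqb.trans ?_
    have := hb t ht
    have := hB t
    gcongr
  have hmain := coin_log_wealth (hW0 ▸ hW) hApos hB hσ hs hqB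
  have hlow : S * q - V * q ^ 2 ≤ ∑ t ∈ Finset.range T, Real.log (1 - σ t * q) := by
    have : S * q - V * q ^ 2 = ∑ t ∈ Finset.range T, (-(σ t * q) - (σ t * q) ^ 2) := by
      rw [Finset.sum_sub_distrib, Finset.sum_neg_distrib, hS, hV, ← Finset.sum_mul]
      simp only [mul_pow]
      rw [← Finset.sum_mul]
      ring
    rw [this]
    refine Finset.sum_le_sum fun t ht => neg_sub_sq_le_log_one_sub ?_
    rw [abs_mul]
    calc |σ t| * |q| ≤ B t * (1 / (2 * B t)) :=
          mul_le_mul (hσ t) (hqB t (Finset.mem_range.1 ht)) (abs_nonneg _) (hB t).le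
      _ = 1 / 2 := by have := (hB t).ne'; field_simp
  have hAT := coinState_A_pos hApos hs T
  have hAle := coinState_A_le hB hσ hs hb
  have hlogA : Real.log (s T).A - Real.log (s 0).A ≤ Real.log (1 + 4 * T * b ^ 2 / B 0 ^ 2) := by
    rw [← Real.log_div hAT.ne' hApos.ne']
    refine Real.log_le_log (by positivity) ?_
    rw [div_le_iff₀ hApos]
    refine hAle.trans (le_of_eq ?_)
    rw [hA0]
    have := (hB 0).ne'
    field_simp
  have hlogW : Real.log (s T).wealth - Real.log W ≤ Real.log (1 + U * T * b / W) := by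
    rw [← Real.log_div hWT.ne' hW.ne']
    refine Real.log_le_log (by positivity) ?_
    have h1 : (s T).wealth ≤ U * (T * b) := hc.le.trans (by gcongr)
    have h2 : (s T).wealth / W ≤ U * T * b / W := by
      gcongr; linarith
    linarith
  have hAq : (s 0).A * ((s 0).raw - q) ^ 2 ≤ 1 / 4 := by
    rw [hA0, hr0]
    have h1 : B 0 * q ≤ 1 / 2 := by
      calc B 0 * q ≤ b * (1 / (2 * b)) := by
            gcongr
        _ = 1 / 2 := by field_simp
    have h0 : 0 ≤ B 0 * q := by have := hB 0; positivity
    nlinarith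
  have hAT2 : 0 ≤ (s T).A * ((s T).raw - q) ^ 2 := by positivity
  have hkey : S * q - V * q ^ 2 ≤ Λ := by
    rw [hW0] at hmain
    linarith
  exact le_of_mul_sub_mul_sq_le hb0 hV0 (by linarith) hkey

/-! ### Adaptive gradient descent on the unit ball -/

theorem norm_ballProj_sub_le {d : ℕ} (y u : Vec d) (hu : ‖u‖ ≤ 1) :
    ‖(1 / max 1 ‖y‖) • y - u‖ ^ 2 ≤ ‖y - u‖ ^ 2 := by
  rcases le_total ‖y‖ 1 with hy | hy
  · rw [max_eq_left hy]; simp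
  · rw [max_eq_right hy, norm_sub_sq_real, norm_sub_sq_real, norm_smul, inner_smul_left]
    have hy0 : 0 < ‖y‖ := by linarith
    have hi : inner ℝ y u ≤ ‖y‖ := by
      calc inner ℝ y u ≤ ‖y‖ * ‖u‖ := real_inner_le_norm y u
        _ ≤ ‖y‖ * 1 := by gcongr
        _ = ‖y‖ := mul_one _
    simp only [conj_trivial]
    have e : ‖(1 / ‖y‖ : ℝ)‖ * ‖y‖ = 1 := by
      rw [Real.norm_of_nonneg (by positivity)]; field_simp
    rw [e]
    have h1 : 1 / ‖y‖ * inner ℝ y u ≤ 1 := by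
      rw [one_div, inv_mul_le_iff₀ hy0]; linarith
    have h2 : inner ℝ y u = ‖y‖ * (1 / ‖y‖ * inner ℝ y u) := by field_simp
    generalize 1 / ‖y‖ * inner ℝ y u = z at *
    rw [h2]
    nlinarith [mul_nonneg (sub_nonneg.2 hy) (sub_nonneg.2 h1)]

theorem dirState_norm_le {d : ℕ} {s : ℕ → DirState d} {v : ℕ → Vec d} (h0 : s 0 = ⟨0, 0⟩)
    (hs : ∀ t, s (t + 1) = (s t).step (v t)) (t : ℕ) : ‖(s t).dir‖ ≤ 1 := by
  cases t with
  | zero => rw [h0]; simp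
  | succ t =>
    rw [hs]
    simp only [DirState.step]
    generalize (s t).dir - _ = y
    rw [norm_smul, Real.norm_of_nonneg (by positivity), one_div,
      inv_mul_le_iff₀ (by positivity)]
    simp

theorem dirState_Q_eq {d : ℕ} {s : ℕ → DirState d} {v : ℕ → Vec d} (h0 : s 0 = ⟨0, 0⟩)
    (hs : ∀ t, s (t + 1) = (s t).step (v t)) (T : ℕ) :
    (s T).Q = ∑ t ∈ Finset.range T, ‖v t‖ ^ 2 := by
  induction T with
  | zero => rw [h0]; simp
  | succ T ih => rw [hs, Finset.sum_range_succ, ← ih]; rfl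

/-- Regret of adaptive gradient descent. The potential `√Q ‖θ - u‖ ^ 2 / 2` absorbs the change of
the step size, because the diameter of the ball is `2`. -/
theorem dir_regret {d : ℕ} {s : ℕ → DirState d} {v : ℕ → Vec d} (h0 : s 0 = ⟨0, 0⟩)
    (hs : ∀ t, s (t + 1) = (s t).step (v t)) (T : ℕ) {u : Vec d} (hu : ‖u‖ ≤ 1) :
    ∑ t ∈ Finset.range T, inner ℝ (v t) ((s t).dir - u) ≤
      3 * √(∑ t ∈ Finset.range T, ‖v t‖ ^ 2) := by
  suffices h : ∑ t ∈ Finset.range T, inner ℝ (v t) ((s t).dir - u)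
      + √(s T).Q * ‖(s T).dir - u‖ ^ 2 / 2 ≤ 3 * √(s T).Q by
    rw [← dirState_Q_eq h0 hs]
    have : 0 ≤ √(s T).Q * ‖(s T).dir - u‖ ^ 2 / 2 := by positivity
    linarith
  induction T with
  | zero => simp [h0]
  | succ T ih =>
    have hQ0 : 0 ≤ (s T).Q := by rw [dirState_Q_eq h0 hs]; positivity
    rw [Finset.sum_range_succ, hs]
    simp only [DirState.step]
    set θ := (s T).dir
    set Q := (s T).Q
    set Q' := Q + ‖v T‖ ^ 2 with hQ'
    have hθ : ‖θ - u‖ ≤ 2 := by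
      have := dirState_norm_le h0 hs T
      have := norm_sub_le θ u
      linarith
    have hpr := norm_ballProj_sub_le (θ - (1 / √Q') • v T) u hu
    have hle : √Q ≤ √Q' := Real.sqrt_le_sqrt (by simp [hQ'])
    have hθ2 : ‖θ - u‖ ^ 2 ≤ 4 := by nlinarith [norm_nonneg (θ - u)]
    rcases (Real.sqrt_nonneg Q').eq_or_lt with hz | hz
    · have hQz : Q' = 0 := (Real.sqrt_eq_zero (by positivity)).1 hz.symm
      have hv : v T = 0 := by
        have h2 : ‖v T‖ ^ 2 = 0 := by nlinarith [sq_nonneg ‖v T‖]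
        simpa using h2
      have hq : √Q = 0 := le_antisymm (by linarith) (Real.sqrt_nonneg _)
      rw [← hz, hv]
      rw [hq] at ih
      simp only [inner_zero_left]
      linarith
    · have hexp : ‖θ - (1 / √Q') • v T - u‖ ^ 2
          = ‖θ - u‖ ^ 2 - 2 / √Q' * inner ℝ (v T) (θ - u) + ‖v T‖ ^ 2 / √Q' ^ 2 := by
        rw [sub_right_comm, norm_sub_sq_real, inner_smul_right, norm_smul, real_inner_comm]
        rw [Real.norm_of_nonneg (by positivity)]
        ring
      rw [hexp] at hpr
      have hsq : √Q' * √Q' = √Q * √Q + ‖v T‖ ^ 2 := by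
        rw [Real.mul_self_sqrt (by positivity), Real.mul_self_sqrt hQ0]
      have hv2 : ‖v T‖ ^ 2 / √Q' ≤ 2 * (√Q' - √Q) := by
        rw [div_le_iff₀ hz]
        nlinarith [sq_nonneg (√Q' - √Q)]
      have h3 := mul_le_mul_of_nonneg_left hpr (by positivity : 0 ≤ √Q' / 2)
      have e3 : √Q' / 2 * (‖θ - u‖ ^ 2 - 2 / √Q' * inner ℝ (v T) (θ - u) + ‖v T‖ ^ 2 / √Q' ^ 2)
          = √Q' / 2 * ‖θ - u‖ ^ 2 - inner ℝ (v T) (θ - u) + ‖v T‖ ^ 2 / √Q' / 2 := by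
        field_simp
      rw [e3] at h3
      have h4 := mul_le_mul_of_nonneg_left hθ2 (sub_nonneg.2 hle)
      linarith

/-! ### The Huber regularizer -/

section Huber

variable {d : ℕ} {c p α S : ℝ}

theorem huber_zero_left (hp : 1 < p) : huber c p α S (0 : Vec d) = fun _ => 0 := by
  funext w
  unfold huber
  rw [norm_zero]
  split_ifs with h
  · rw [le_antisymm h (norm_nonneg w), Real.zero_rpow (by linarith)]; simp
  · rw [Real.zero_rpow (by linarith)]; simp

/-- The radial profile of the Huber regularizer: a power, continued by its tangent beyond `ρ`. -/
theorem hasDerivAt_radial {ρ : ℝ} (hρ : 0 < ρ) :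
    HasDerivAt (fun x : ℝ => if x ≤ ρ then c * x ^ p / (S + α ^ p) ^ (1 - 1 / p)
      else c * (p * x - (p - 1) * ρ) * ρ ^ (p - 1) / (S + α ^ p) ^ (1 - 1 / p))
      (c * p * ρ ^ (p - 1) / (S + α ^ p) ^ (1 - 1 / p)) ρ := by
  have hpow : ρ ^ p = ρ * ρ ^ (p - 1) := by
    rw [Real.rpow_sub_one hρ.ne']; field_simp
  have h1 : HasDerivAt (fun x : ℝ => c * x ^ p / (S + α ^ p) ^ (1 - 1 / p))
      (c * p * ρ ^ (p - 1) / (S + α ^ p) ^ (1 - 1 / p)) ρ := by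
    refine (((Real.hasDerivAt_rpow_const (Or.inl hρ.ne')).const_mul c).div_const _).congr_deriv ?_
    ring
  have h2 : HasDerivAt
      (fun x : ℝ => c * (p * x - (p - 1) * ρ) * ρ ^ (p - 1) / (S + α ^ p) ^ (1 - 1 / p))
      (c * p * ρ ^ (p - 1) / (S + α ^ p) ^ (1 - 1 / p)) ρ := by
    refine ((((((hasDerivAt_id ρ).const_mul p).sub_const ((p - 1) * ρ)).const_mul c).mul_const
      (ρ ^ (p - 1))).div_const _).congr_deriv ?_
    ring
  rw [← hasDerivWithinAt_univ, ← Set.Iic_union_Ici (a := ρ)]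
  refine HasDerivWithinAt.union ?_ ?_
  · refine h1.hasDerivWithinAt.congr (fun x hx => if_pos hx) (if_pos le_rfl)
  · have hat : c * ρ ^ p / (S + α ^ p) ^ (1 - 1 / p)
        = c * (p * ρ - (p - 1) * ρ) * ρ ^ (p - 1) / (S + α ^ p) ^ (1 - 1 / p) := by
      rw [hpow]; ring
    refine h2.hasDerivWithinAt.congr (fun x hx => ?_) (by rw [if_pos le_rfl, hat])
    rcases (Set.mem_Ici.1 hx).eq_or_lt with h | h
    · rw [← h, if_pos le_rfl, hat]
    · rw [if_neg (not_le.2 h)]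

theorem gradient_huber (hp : 1 < p) (w : Vec d) :
    gradient (huber c p α S w) w
      = (c * p * ‖w‖ ^ (p - 2) / (S + α ^ p) ^ (1 - 1 / p)) • w := by
  by_cases hw : w = 0
  · subst hw
    rw [huber_zero_left hp, smul_zero]
    exact (hasGradientAt_const _ _).gradient
  · have hρ : 0 < ‖w‖ := norm_pos_iff.2 hw
    have hn : HasGradientAt (fun x : Vec d => ‖x‖) (‖w‖⁻¹ • w) w := by
      have h1 : HasFDerivAt (fun x : Vec d => ‖x‖ ^ 2) (2 • innerSL ℝ w) w :=
        (hasStrictFDerivAt_norm_sq w).hasFDerivAt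
      have h2 := h1.sqrt (by positivity)
      simp only [Real.sqrt_sq (norm_nonneg _)] at h2
      rw [hasGradientAt_iff_hasFDerivAt]
      refine h2.congr_fderiv ?_
      ext x
      simp
      field_simp
    have h := HasFDerivAt.comp w
      (hasDerivAt_radial (c := c) (p := p) (α := α) (S := S) hρ).hasFDerivAt
      (hasGradientAt_iff_hasFDerivAt.1 hn)
    have h' : HasGradientAt (huber c p α S w)
        ((c * p * ‖w‖ ^ (p - 2) / (S + α ^ p) ^ (1 - 1 / p)) • w) w := by
      rw [hasGradientAt_iff_hasFDerivAt]
      refine h.congr_fderiv ?_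
      ext x
      have e : ‖w‖ ^ (p - 1) = ‖w‖ * ‖w‖ ^ (p - 2) := by
        rw [show p - 2 = p - 1 - 1 by ring, Real.rpow_sub_one hρ.ne' (p - 1)]; field_simp
      simp [e]
      field_simp
    exact h'.gradient

theorem norm_gradient_huber (hp : 1 < p) (hc : 0 < c) (hα : 0 < α) (hS : 0 ≤ S) (w : Vec d) :
    ‖gradient (huber c p α S w) w‖
      = c * p * (‖w‖ ^ (p - 1) / (S + α ^ p) ^ (1 - 1 / p)) := by
  have hA : 0 < α ^ p := Real.rpow_pos_of_pos hα p
  rw [gradient_huber hp, norm_smul, Real.norm_of_nonneg (by positivity)]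
  rcases (norm_nonneg w).eq_or_lt with h | h
  · rw [← h, Real.zero_rpow (by linarith : p - 1 ≠ 0)]; simp
  · have e : ‖w‖ ^ (p - 1) = ‖w‖ * ‖w‖ ^ (p - 2) := by
      rw [show p - 2 = p - 1 - 1 by ring, Real.rpow_sub_one h.ne' (p - 1)]; field_simp
    rw [e]; ring

/-- The tangent of the Huber regularizer at `w`, where its value is the first summand, lies
below it. -/
theorem huber_tangent_le (hp : 1 < p) (hc : 0 < c) (hα : 0 < α) (hS : 0 ≤ S) (w u : Vec d) :
    c * (‖w‖ ^ p / (S + α ^ p) ^ (1 - 1 / p)) + inner ℝ (gradient (huber c p α S w) w) (u - w)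
      ≤ huber c p α S w u := by
  rw [gradient_huber hp]
  have hA : 0 < α ^ p := Real.rpow_pos_of_pos hα p
  have hD : 0 < (S + α ^ p) ^ (1 - 1 / p) := by positivity
  unfold huber
  generalize (S + α ^ p) ^ (1 - 1 / p) = D at *
  rcases (norm_nonneg w).eq_or_lt with h | h
  · have hw : w = 0 := norm_eq_zero.1 h.symm
    subst hw
    rw [norm_zero, Real.zero_rpow (by linarith)]
    simp only [smul_zero, inner_zero_left, zero_div, mul_zero, add_zero]
    split_ifs with h2
    · positivity
    · rw [Real.zero_rpow (by linarith)]; simp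
  set ρ := ‖w‖ with hρ
  have e1 : ρ ^ p = ρ * ρ ^ (p - 1) := by rw [Real.rpow_sub_one h.ne']; field_simp
  have e2 : ρ ^ (p - 1) = ρ * ρ ^ (p - 2) := by
    rw [show p - 2 = p - 1 - 1 by ring, Real.rpow_sub_one h.ne' (p - 1)]; field_simp
  have hin : inner ℝ w (u - w) ≤ ρ * (‖u‖ - ρ) := by
    rw [inner_sub_right, real_inner_self_eq_norm_sq]
    have := real_inner_le_norm w u
    rw [← hρ] at this ⊢
    nlinarith
  have hlin : inner ℝ ((c * p * ρ ^ (p - 2) / D) • w) (u - w)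
      ≤ c * p * ρ ^ (p - 1) / D * (‖u‖ - ρ) := by
    rw [inner_smul_left, conj_trivial, e2]
    calc c * p * ρ ^ (p - 2) / D * inner ℝ w (u - w)
        ≤ c * p * ρ ^ (p - 2) / D * (ρ * (‖u‖ - ρ)) := by gcongr
      _ = _ := by ring
  split_ifs with h2
  · have hb := one_add_mul_self_le_rpow_one_add (s := ‖u‖ / ρ - 1)
      (by have : 0 ≤ ‖u‖ / ρ := by positivity
          linarith) hp.le
    rw [add_sub_cancel, Real.div_rpow (norm_nonneg u) h.le] at hb
    have hb2 : ρ ^ p + p * ρ ^ (p - 1) * (‖u‖ - ρ) ≤ ‖u‖ ^ p := by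
      have hρp : 0 < ρ ^ p := Real.rpow_pos_of_pos h p
      rw [le_div_iff₀ hρp] at hb
      refine le_trans (le_of_eq ?_) hb
      rw [e1]; field_simp
    calc _ ≤ c * (ρ ^ p / D) + c * p * ρ ^ (p - 1) / D * (‖u‖ - ρ) := by gcongr
      _ = c * (ρ ^ p + p * ρ ^ (p - 1) * (‖u‖ - ρ)) / D := by ring
      _ ≤ _ := by gcongr
  · refine (add_le_add_right hlin _).trans (le_of_eq ?_)
    rw [e1]; ring

theorem huber_le (hp : 1 < p) (hc : 0 < c) (hα : 0 < α) (hS : 0 ≤ S) (w u : Vec d) :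
    huber c p α S w u ≤ c * p * ‖u‖ * (‖w‖ ^ (p - 1) / (S + α ^ p) ^ (1 - 1 / p)) := by
  have hA : 0 < α ^ p := Real.rpow_pos_of_pos hα p
  have hD : 0 < (S + α ^ p) ^ (1 - 1 / p) := by positivity
  unfold huber
  generalize (S + α ^ p) ^ (1 - 1 / p) = D at *
  have hw : 0 ≤ ‖w‖ ^ (p - 1) := by positivity
  split_ifs with h2
  · have h3 : ‖u‖ ^ p ≤ ‖u‖ * ‖w‖ ^ (p - 1) := by
      rcases (norm_nonneg u).eq_or_lt with h | h
      · rw [← h, Real.zero_rpow (by linarith)]; simp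
      · rw [show ‖u‖ ^ p = ‖u‖ * ‖u‖ ^ (p - 1) by
          rw [Real.rpow_sub_one h.ne']; field_simp]
        gcongr
    calc c * ‖u‖ ^ p / D ≤ c * (‖u‖ * ‖w‖ ^ (p - 1)) / D := by gcongr
      _ = 1 * (c * (‖u‖ * ‖w‖ ^ (p - 1)) / D) := by ring
      _ ≤ p * (c * (‖u‖ * ‖w‖ ^ (p - 1)) / D) := by gcongr
      _ = _ := by ring
  · calc c * (p * ‖u‖ - (p - 1) * ‖w‖) * ‖w‖ ^ (p - 1) / D
        ≤ c * (p * ‖u‖) * ‖w‖ ^ (p - 1) / D := by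
          gcongr
          have : 0 ≤ (p - 1) * ‖w‖ := by
            have : 0 ≤ p - 1 := by linarith
            positivity
          linarith
      _ = _ := by ring

/-- The choice `p = log T` makes `T ^ (1 / p) = e`, which linearizes the exponent `1 - 1 / p`. -/
theorem ratio_rpow_le {T : ℕ} (hT : 3 ≤ T) {w B : ℝ} (hw : 0 ≤ w) (hB : 0 < B) :
    w ^ (Real.log T - 1) / B ^ (1 - 1 / Real.log T)
      ≤ Real.exp 1 * (1 / T + w ^ Real.log T / B) := by
  have hT0 : (0 : ℝ) < T := by positivity
  have hp : 1 < Real.log T := by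
    rw [Real.lt_log_iff_exp_lt hT0]
    have : (3 : ℝ) ≤ T := by exact_mod_cast hT
    linarith [Real.exp_one_lt_d9]
  set p := Real.log T with hpdef
  have hr : 0 ≤ w ^ p / B := by positivity
  have h1 : w ^ (p - 1) / B ^ (1 - 1 / p) = (w ^ p / B) ^ (1 - 1 / p) := by
    rw [Real.div_rpow (by positivity) hB.le, ← Real.rpow_mul hw]
    congr 2
    field_simp
  have h2 := Real.geom_mean_le_arith_mean2_weighted (w₁ := 1 - 1 / p) (w₂ := 1 / p)
    (by rw [sub_nonneg, div_le_one (by linarith)]; exact hp.le) (by positivity) hr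
    (by positivity : (0:ℝ) ≤ 1 / T) (by ring)
  have h3 : (1 / (T : ℝ)) ^ (1 / p) = Real.exp (-1) := by
    rw [Real.rpow_def_of_pos (by positivity), one_div (T : ℝ), Real.log_inv, ← hpdef]
    congr 1; field_simp
  rw [h3] at h2
  rw [h1]
  have h4 : (1 - 1 / p) * (w ^ p / B) + 1 / p * (1 / T) ≤ 1 / T + w ^ p / B := by
    have i1 : 1 / p ≤ 1 := by rw [div_le_one (by linarith)]; exact hp.le
    have i2 : 0 ≤ 1 / p := by positivity
    have i3 : (0:ℝ) ≤ 1 / T := by positivity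
    nlinarith
  have h5 : (w ^ p / B) ^ (1 - 1 / p)
      = Real.exp 1 * ((w ^ p / B) ^ (1 - 1 / p) * Real.exp (-1)) := by
    rw [mul_left_comm, ← Real.exp_add]; simp
  rw [h5]
  gcongr
  exact h2.trans h4

theorem ratio_rpow_le_one {p w B : ℝ} (hp : 1 < p) (hw : 0 ≤ w) (hwB : w ^ p ≤ B) (hB : 0 < B) :
    w ^ (p - 1) / B ^ (1 - 1 / p) ≤ 1 := by
  rw [div_le_one (by positivity)]
  calc w ^ (p - 1) = (w ^ p) ^ (1 - 1 / p) := by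
        rw [← Real.rpow_mul hw]; congr 1; field_simp
    _ ≤ _ := by
      refine Real.rpow_le_rpow (by positivity) hwB ?_
      rw [sub_nonneg, div_le_one (by linarith)]; exact hp.le

/-- Ratios of terms to partial sums add up to a logarithm. -/
theorem sum_div_partial_sum_le {A : ℝ} (hA : 0 < A) {x : ℕ → ℝ} (hx : ∀ t, 0 ≤ x t) (T : ℕ) :
    ∑ t ∈ Finset.range T, x t / (∑ i ∈ Finset.range (t + 1), x i + A)
      ≤ Real.log ((∑ i ∈ Finset.range T, x i + A) / A) := by
  have hpos : ∀ t, 0 < ∑ i ∈ Finset.range t, x i + A := fun t => by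
    have := Finset.sum_nonneg (s := Finset.range t) fun i _ => hx i
    linarith
  induction T with
  | zero => simp [div_self hA.ne']
  | succ T ih =>
    rw [Finset.sum_range_succ]
    have h1 := hpos T
    have h2 := hpos (T + 1)
    rw [Real.log_div (hpos _).ne' hA.ne'] at ih ⊢
    have h3 := Real.one_sub_inv_le_log_of_pos (div_pos h2 h1)
    rw [Real.log_div h2.ne' h1.ne'] at h3
    have e : 1 - ((∑ i ∈ Finset.range (T + 1), x i + A) / (∑ i ∈ Finset.range T, x i + A))⁻¹
        = x T / (∑ i ∈ Finset.range (T + 1), x i + A) := by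
      rw [inv_div, one_sub_div h2.ne', Finset.sum_range_succ]; ring
    linarith

/-- The Huber regularizer at the plays sums up to the `ℓ^p` norm of the norms of the plays,
by concavity of `x ↦ x ^ (1 / p)`. -/
theorem le_sum_div_partial_sum_rpow {A p : ℝ} (hA : 0 < A) (hp : 1 < p) {x : ℕ → ℝ}
    (hx : ∀ t, 0 ≤ x t) (T : ℕ) :
    (∑ i ∈ Finset.range T, x i + A) ^ (1 / p) - A ^ (1 / p)
      ≤ ∑ t ∈ Finset.range T, x t / (∑ i ∈ Finset.range (t + 1), x i + A) ^ (1 - 1 / p) := by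
  have hpos : ∀ t, 0 < ∑ i ∈ Finset.range t, x i + A := fun t => by
    have := Finset.sum_nonneg (s := Finset.range t) fun i _ => hx i
    linarith
  induction T with
  | zero => simp
  | succ T ih =>
    rw [Finset.sum_range_succ (fun t => x t / _)]
    have h1 := hpos T
    have h2 := hpos (T + 1)
    have hxe : x T = (∑ i ∈ Finset.range (T + 1), x i + A) - (∑ i ∈ Finset.range T, x i + A) := by
      rw [Finset.sum_range_succ]; ring
    have hle : ∑ i ∈ Finset.range T, x i + A ≤ ∑ i ∈ Finset.range (T + 1), x i + A := by
      linarith [hx T]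
    rw [hxe]
    generalize ∑ i ∈ Finset.range T, x i + A = a at *
    generalize ∑ i ∈ Finset.range (T + 1), x i + A = b at *
    have h3 : b ^ (1 / p) - a ^ (1 / p) ≤ (b - a) / b ^ (1 - 1 / p) := by
      rw [le_div_iff₀ (by positivity), sub_mul, ← Real.rpow_add h2]
      have h4 : a ≤ a ^ (1 / p) * b ^ (1 - 1 / p) := by
        calc a = a ^ (1 / p) * a ^ (1 - 1 / p) := by rw [← Real.rpow_add h1]; simp
          _ ≤ _ := by
            gcongr
            rw [sub_nonneg, div_le_one (by linarith)]; exact hp.le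
      simp only [add_sub_cancel, Real.rpow_one]
      linarith
    linarith

end Huber

/-! ### Projection to the epigraph -/

section Epigraph

variable {d : ℕ} {h γ : ℝ} {q r : Vec d × ℝ}

theorem augNorm_sq (h γ : ℝ) (q : Vec d × ℝ) :
    augNorm h γ q ^ 2 = h ^ 2 * ‖q.1‖ ^ 2 + γ ^ 2 * q.2 ^ 2 :=
  Real.sq_sqrt (by positivity)

theorem augNorm_nonneg (h γ : ℝ) (q : Vec d × ℝ) : 0 ≤ augNorm h γ q := Real.sqrt_nonneg _

/-- The variational inequality of the projection. -/
theorem IsEpiProj.inner_le (hr : IsEpiProj h γ q r) {r' : Vec d × ℝ} (hr' : r' ∈ epigraph d) :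
    h ^ 2 * inner ℝ (q.1 - r.1) (r'.1 - r.1) + γ ^ 2 * ((q.2 - r.2) * (r'.2 - r.2)) ≤ 0 := by
  set I := h ^ 2 * inner ℝ (q.1 - r.1) (r'.1 - r.1) + γ ^ 2 * ((q.2 - r.2) * (r'.2 - r.2)) with hI
  set N := h ^ 2 * ‖r'.1 - r.1‖ ^ 2 + γ ^ 2 * (r'.2 - r.2) ^ 2 with hN
  have hN0 : 0 ≤ N := by positivity
  have key : ∀ s : ℝ, 0 < s → s ≤ 1 → 2 * I ≤ s * N := by
    intro s hs0 hs1
    have hmem : r + s • (r' - r) ∈ epigraph d := by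
      have h1 : ‖r.1‖ ^ 2 ≤ r.2 := hr.1
      have h2 : ‖r'.1‖ ^ 2 ≤ r'.2 := hr'
      change ‖r.1 + s • (r'.1 - r.1)‖ ^ 2 ≤ r.2 + s * (r'.2 - r.2)
      have e : r.1 + s • (r'.1 - r.1) = (1 - s) • r.1 + s • r'.1 := by module
      have hn : ‖r.1 + s • (r'.1 - r.1)‖ ≤ (1 - s) * ‖r.1‖ + s * ‖r'.1‖ := by
        rw [e]
        refine (norm_add_le _ _).trans (le_of_eq ?_)
        rw [norm_smul, norm_smul, Real.norm_of_nonneg hs0.le,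
          Real.norm_of_nonneg (by linarith : 0 ≤ 1 - s)]
      have hn2 := pow_le_pow_left₀ (norm_nonneg _) hn 2
      have h3 := mul_nonneg (mul_nonneg hs0.le (by linarith : 0 ≤ 1 - s))
        (sq_nonneg (‖r.1‖ - ‖r'.1‖))
      nlinarith [mul_le_mul_of_nonneg_left h1 (by linarith : 0 ≤ 1 - s),
        mul_le_mul_of_nonneg_left h2 hs0.le]
    have h4 := pow_le_pow_left₀ (augNorm_nonneg _ _ _) (hr.2 _ hmem) 2
    rw [augNorm_sq, augNorm_sq] at h4
    have e1 : (q - (r + s • (r' - r))).1 = (q.1 - r.1) - s • (r'.1 - r.1) := by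
      simp only [Prod.fst_sub, Prod.fst_add, Prod.smul_fst]; abel
    have e2 : (q - (r + s • (r' - r))).2 = (q.2 - r.2) - s * (r'.2 - r.2) := by
      simp only [Prod.snd_sub, Prod.snd_add, Prod.smul_snd, smul_eq_mul]; ring
    rw [e1, e2, norm_sub_sq_real, inner_smul_right, norm_smul, Real.norm_of_nonneg hs0.le] at h4
    simp only [Prod.fst_sub, Prod.snd_sub] at h4
    have h5 : s * (2 * I) ≤ s * (s * N) := by rw [hI, hN]; nlinarith
    exact le_of_mul_le_mul_left h5 hs0
  by_contra hpos
  push Not at hpos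
  have h6 := key (min 1 (I / (N + 1))) (by positivity) (min_le_left _ _)
  have h7 : min 1 (I / (N + 1)) * N ≤ I / (N + 1) * (N + 1) := by
    refine mul_le_mul (min_le_right _ _) (by linarith) hN0 (by positivity)
  rw [div_mul_cancel₀ _ (by positivity)] at h7
  linarith

/-- The projection does not move the first coordinates outward; so radial slopes, like the
gradient of the Huber regularizer, may be evaluated at the unprojected point. -/
theorem IsEpiProj.inner_nonneg (hr : IsEpiProj h γ q r) (hh : 0 < h) :
    0 ≤ inner ℝ r.1 (q.1 - r.1) := by
  -- shrinking the first coordinates stays in the epigraph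
  have hmem : ((1 / 2 : ℝ) • r.1, r.2) ∈ epigraph d := by
    have h1 : ‖r.1‖ ^ 2 ≤ r.2 := hr.1
    change ‖(1 / 2 : ℝ) • r.1‖ ^ 2 ≤ r.2
    rw [norm_smul, mul_pow]
    norm_num
    nlinarith [sq_nonneg ‖r.1‖]
  have h2 := hr.inner_le hmem
  have e : (1 / 2 : ℝ) • r.1 - r.1 = (-(1 / 2) : ℝ) • r.1 := by module
  simp only [e, sub_self, mul_zero, add_zero, inner_smul_right] at h2
  rw [real_inner_comm] at h2
  have h3 : 0 ≤ h ^ 2 * inner ℝ r.1 (q.1 - r.1) := by linarith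
  exact (mul_nonneg_iff_of_pos_left (by positivity)).1 h3

theorem IsEpiProj.snd_le (hr : IsEpiProj h γ q r) (hγ : 0 < γ) : q.2 ≤ r.2 := by
  have hmem : (r.1, r.2 + 1) ∈ epigraph d := by
    have h1 : ‖r.1‖ ^ 2 ≤ r.2 := hr.1
    change ‖r.1‖ ^ 2 ≤ r.2 + 1
    linarith
  have h2 := hr.inner_le hmem
  simp only [sub_self, inner_zero_right, mul_zero, add_sub_cancel_left, mul_one, zero_add] at h2
  have h3 : 0 ≤ γ ^ 2 * (r.2 - q.2) := by linarith
  linarith [(mul_nonneg_iff_of_pos_left (by positivity : 0 < γ ^ 2)).1 h3]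

/-- Passing from the constrained to the unconstrained learner: the slopes corrected by the
gradient of the distance to the epigraph overestimate the regret of the projected point. -/
theorem IsEpiProj.regret_le (hr : IsEpiProj h γ q r) (hh : 0 < h) (hγ : 0 < γ) (gc : Vec d)
    {a κ : ℝ} (hκ : 0 ≤ κ) {ρ : ℝ} (hρ : ρ = √(‖gc‖ ^ 2 / h ^ 2 + a ^ 2 / γ ^ 2)) (u : Vec d) :
    inner ℝ gc (r.1 - u) + inner ℝ (κ • r.1) (r.1 - u) + a * (r.2 - ‖u‖ ^ 2) ≤
      inner ℝ (gc + κ • r.1 + (ρ * h ^ 2 / augNorm h γ (q - r)) • (q.1 - r.1)) (q.1 - u)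
        + (a + ρ * γ ^ 2 / augNorm h γ (q - r) * (q.2 - r.2)) * (q.2 - ‖u‖ ^ 2) := by
  set D := augNorm h γ (q - r) with hD
  have hD0 : 0 ≤ D := augNorm_nonneg _ _ _
  have hD2 : D ^ 2 = h ^ 2 * ‖q.1 - r.1‖ ^ 2 + γ ^ 2 * (q.2 - r.2) ^ 2 := augNorm_sq _ _ _
  have hρ0 : 0 ≤ ρ := hρ ▸ Real.sqrt_nonneg _
  have hρ2 : ρ ^ 2 = ‖gc‖ ^ 2 / h ^ 2 + a ^ 2 / γ ^ 2 := by
    rw [hρ, Real.sq_sqrt (by positivity)]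
  have hvi := hr.inner_le (show (u, ‖u‖ ^ 2) ∈ epigraph d from le_refl (‖u‖ ^ 2))
  have hin := hr.inner_nonneg hh
  -- Cauchy–Schwarz for the pairing of `augNorm` with its dual norm
  have hcs : -(ρ * D) ≤ inner ℝ gc (q.1 - r.1) + a * (q.2 - r.2) := by
    have h1 : -(‖gc‖ * ‖q.1 - r.1‖) ≤ inner ℝ gc (q.1 - r.1) :=
      (abs_le.1 (abs_real_inner_le_norm gc (q.1 - r.1))).1
    have h2 : -(|a| * |q.2 - r.2|) ≤ a * (q.2 - r.2) := by
      rw [← abs_mul]; exact neg_abs_le _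
    have h3 : ‖gc‖ * ‖q.1 - r.1‖ + |a| * |q.2 - r.2| ≤ ρ * D := by
      refine le_of_sq_le_sq ?_ (by positivity)
      rw [mul_pow, hρ2, hD2]
      have e : (‖gc‖ ^ 2 / h ^ 2 + a ^ 2 / γ ^ 2)
            * (h ^ 2 * ‖q.1 - r.1‖ ^ 2 + γ ^ 2 * (q.2 - r.2) ^ 2)
          - (‖gc‖ * ‖q.1 - r.1‖ + |a| * |q.2 - r.2|) ^ 2
          = (‖gc‖ / h * γ * |q.2 - r.2| - |a| / γ * h * ‖q.1 - r.1‖) ^ 2 := by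
        rw [← sq_abs a, ← sq_abs (q.2 - r.2)]
        field_simp
        ring
      nlinarith [sq_nonneg (‖gc‖ / h * γ * |q.2 - r.2| - |a| / γ * h * ‖q.1 - r.1‖)]
    linarith
  have hdist : ρ * D ≤ ρ / D * (h ^ 2 * inner ℝ (q.1 - r.1) (q.1 - u)
      + γ ^ 2 * ((q.2 - r.2) * (q.2 - ‖u‖ ^ 2))) := by
    -- this holds for `D = 0` too, by the convention for division
    have e : ρ * D = ρ / D * D ^ 2 := by
      rcases hD0.eq_or_lt with h0 | h0
      · rw [← h0]; simp
      · field_simp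
    rw [e]
    refine mul_le_mul_of_nonneg_left ?_ (by positivity)
    have e1 : inner ℝ (q.1 - r.1) (q.1 - u)
        = ‖q.1 - r.1‖ ^ 2 - inner ℝ (q.1 - r.1) (u - r.1) := by
      rw [← real_inner_self_eq_norm_sq, ← inner_sub_right]; congr 1; abel
    rw [hD2, e1]
    nlinarith
  have e3 : inner ℝ gc (q.1 - u) = inner ℝ gc (r.1 - u) + inner ℝ gc (q.1 - r.1) := by
    rw [← inner_add_right]; congr 1; abel
  have e4 : inner ℝ r.1 (q.1 - u) = inner ℝ r.1 (r.1 - u) + inner ℝ r.1 (q.1 - r.1) := by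
    rw [← inner_add_right]; congr 1; abel
  rw [inner_add_left, inner_add_left, inner_smul_left, inner_smul_left, inner_smul_left, e3, e4]
  simp only [conj_trivial]
  have e5 : ρ * h ^ 2 / D * inner ℝ (q.1 - r.1) (q.1 - u)
      + ρ * γ ^ 2 / D * (q.2 - r.2) * (q.2 - ‖u‖ ^ 2)
      = ρ / D * (h ^ 2 * inner ℝ (q.1 - r.1) (q.1 - u)
      + γ ^ 2 * ((q.2 - r.2) * (q.2 - ‖u‖ ^ 2))) := by ring
  nlinarith [mul_nonneg hκ hin]

theorem norm_correction_fst_le (hh : 0 < h) {ρ : ℝ} (hρ : 0 ≤ ρ) (z : Vec d × ℝ) :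
    ‖(ρ * h ^ 2 / augNorm h γ z) • z.1‖ ≤ ρ * h := by
  have h0 := augNorm_nonneg h γ z
  rw [norm_smul, Real.norm_of_nonneg (by positivity)]
  have h1 : h * ‖z.1‖ ≤ augNorm h γ z := by
    refine Real.le_sqrt_of_sq_le ?_
    nlinarith [sq_nonneg (γ * z.2)]
  rcases h0.eq_or_lt with h2 | h2
  · rw [← h2]; simp; positivity
  · rw [div_mul_eq_mul_div, div_le_iff₀ h2]
    have : 0 ≤ ρ * h := by positivity
    nlinarith

theorem abs_correction_snd_le (hγ : 0 < γ) {ρ : ℝ} (hρ : 0 ≤ ρ) (z : Vec d × ℝ) :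
    |ρ * γ ^ 2 / augNorm h γ z * z.2| ≤ ρ * γ := by
  have h0 := augNorm_nonneg h γ z
  rw [abs_mul, abs_of_nonneg (by positivity : 0 ≤ ρ * γ ^ 2 / augNorm h γ z)]
  have h1 : γ * |z.2| ≤ augNorm h γ z := by
    refine Real.le_sqrt_of_sq_le ?_
    rw [mul_pow, sq_abs]
    nlinarith [sq_nonneg (h * ‖z.1‖)]
  rcases h0.eq_or_lt with h2 | h2
  · rw [← h2]; simp; positivity
  · rw [div_mul_eq_mul_div, div_le_iff₀ h2]
    have : 0 ≤ ρ * γ := by positivity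
    nlinarith

end Epigraph

/-! ### The filter -/

section Filter

variable {d : ℕ} {k τ : ℝ} {F : ℕ → FilterState} {gt : ℕ → Vec d}

/-- The indicator of a change of the threshold in round `t`. -/
def doubled (F : ℕ → FilterState) (t : ℕ) : ℝ := if (F (t + 1)).h ≠ (F t).h then 1 else 0

theorem doubled_nonneg (F : ℕ → FilterState) (t : ℕ) : 0 ≤ doubled F t := by
  unfold doubled; split_ifs <;> norm_num

theorem alphaWeight_eq (γα : ℝ) (F : ℕ → FilterState) (t : ℕ) :
    alphaWeight γα (F t) (F (t + 1)) = γα * doubled F t := by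
  unfold alphaWeight doubled; split_ifs <;> simp

theorem filter_h_pos (hτ : 0 < τ) (h0 : F 0 = ⟨τ, 0⟩)
    (hF : ∀ t, F (t + 1) = filterStep k (F t) (gt t)) (t : ℕ) : 0 < (F t).h := by
  induction t with
  | zero => rw [h0]; exact hτ
  | succ t ih =>
    rw [hF, filterStep]
    split_ifs <;> simp [ih]

theorem filter_step_cases (hτ : 0 < τ) (h0 : F 0 = ⟨τ, 0⟩)
    (hF : ∀ t, F (t + 1) = filterStep k (F t) (gt t)) (t : ℕ) :
    ((F t).h ≤ ‖gt t‖ ∧ k < (F t).n + 1 ∧ F (t + 1) = ⟨2 * (F t).h, 0⟩ ∧ doubled F t = 1) ∨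
      ((F t).h ≤ ‖gt t‖ ∧ ((F t).n : ℝ) + 1 ≤ k ∧ F (t + 1) = ⟨(F t).h, (F t).n + 1⟩ ∧
        doubled F t = 0) ∨
      (‖gt t‖ < (F t).h ∧ F (t + 1) = F t ∧ doubled F t = 0) := by
  have hpos := filter_h_pos hτ h0 hF t
  by_cases h1 : (F t).h ≤ ‖gt t‖
  · by_cases h2 : k < (F t).n + 1
    · left
      have e : F (t + 1) = ⟨2 * (F t).h, 0⟩ := by rw [hF, filterStep, if_pos h1, if_pos h2]
      refine ⟨h1, h2, e, ?_⟩
      rw [doubled, e, if_pos]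
      simp only
      linarith
    · right; left
      have e : F (t + 1) = ⟨(F t).h, (F t).n + 1⟩ := by rw [hF, filterStep, if_pos h1, if_neg h2]
      exact ⟨h1, not_lt.1 h2, e, by rw [doubled, e]; simp⟩
  · right; right
    have e : F (t + 1) = F t := by rw [hF, filterStep, if_neg h1]
    exact ⟨not_le.1 h1, e, by rw [doubled, e]; simp⟩

theorem filter_h_eq (hτ : 0 < τ) (h0 : F 0 = ⟨τ, 0⟩)
    (hF : ∀ t, F (t + 1) = filterStep k (F t) (gt t)) (T : ℕ) :
    Real.log (F T).h = Real.log τ + (∑ t ∈ Finset.range T, doubled F t) * Real.log 2 := by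
  induction T with
  | zero => simp [h0]
  | succ T ih =>
    have hpos := filter_h_pos hτ h0 hF T
    rw [Finset.sum_range_succ]
    rcases filter_step_cases hτ h0 hF T with ⟨-, -, e, e'⟩ | ⟨-, -, e, e'⟩ | ⟨-, e, e'⟩ <;>
      rw [e, e']
    · rw [Real.log_mul two_ne_zero hpos.ne', ih]; ring
    · simp only [add_zero]; exact ih
    · rw [add_zero]; exact ih

theorem filter_n_le (hk : 0 ≤ k) (hτ : 0 < τ) (h0 : F 0 = ⟨τ, 0⟩)
    (hF : ∀ t, F (t + 1) = filterStep k (F t) (gt t)) (t : ℕ) : ((F t).n : ℝ) ≤ k := by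
  induction t with
  | zero => simpa [h0] using hk
  | succ t ih =>
    rcases filter_step_cases hτ h0 hF t with ⟨-, -, e, -⟩ | ⟨-, h, e, -⟩ | ⟨-, e, -⟩ <;> rw [e]
    · simpa using hk
    · push_cast; exact h
    · exact ih

/-- Rounds that reach the threshold without changing it: at most `k` for every threshold. -/
theorem sum_clipped_le (hk : 0 ≤ k) (hτ : 0 < τ) (h0 : F 0 = ⟨τ, 0⟩)
    (hF : ∀ t, F (t + 1) = filterStep k (F t) (gt t)) (T : ℕ) :
    ∑ t ∈ Finset.range T, (if (F t).h ≤ ‖gt t‖ then 1 - doubled F t else 0)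
      ≤ k * (∑ t ∈ Finset.range T, doubled F t + 1) := by
  suffices h : ∑ t ∈ Finset.range T, (if (F t).h ≤ ‖gt t‖ then 1 - doubled F t else 0)
      ≤ k * ∑ t ∈ Finset.range T, doubled F t + (F T).n by
    have := filter_n_le hk hτ h0 hF T
    linarith
  induction T with
  | zero => simp [h0]
  | succ T ih =>
    have hn := filter_n_le hk hτ h0 hF T
    rw [Finset.sum_range_succ, Finset.sum_range_succ (fun t => doubled F t)]
    rcases filter_step_cases hτ h0 hF T with ⟨h1, -, e, e'⟩ | ⟨h1, -, e, e'⟩ | ⟨h1, e, e'⟩ <;>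
      rw [e, e']
    · rw [if_pos h1]; simp only [Nat.cast_zero]; linarith
    · rw [if_pos h1]; push_cast; linarith
    · rw [if_neg (not_le.2 h1)]; linarith

/-- The counter of the filter counts rounds that reach the current threshold. -/
theorem filter_witnesses (hτ : 0 < τ) (h0 : F 0 = ⟨τ, 0⟩)
    (hF : ∀ t, F (t + 1) = filterStep k (F t) (gt t)) (t : ℕ) :
    ∃ E ⊆ Finset.range t, E.card = (F t).n ∧ ∀ i ∈ E, (F t).h ≤ ‖gt i‖ := by
  induction t with
  | zero => exact ⟨∅, by simp, by simp [h0], by simp⟩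
  | succ t ih =>
    obtain ⟨E, hE, hc, hh⟩ := ih
    have hE' : E ⊆ Finset.range (t + 1) := hE.trans (by simp)
    rcases filter_step_cases hτ h0 hF t with ⟨-, -, e, -⟩ | ⟨h1, -, e, -⟩ | ⟨-, e, -⟩ <;> rw [e]
    · exact ⟨∅, by simp, by simp, by simp⟩
    · refine ⟨insert t E, Finset.insert_subset (by simp) hE', ?_, ?_⟩
      · rw [Finset.card_insert_of_notMem (fun h => by simpa using hE h), hc]
      · intro i hi
        rcases Finset.mem_insert.1 hi with rfl | hi
        · exact h1
        · exact hh i hi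
    · exact ⟨E, hE', hc, hh⟩

/-- A threshold is only left after more than `k` rounds reached it, one of which is therefore
received with corruption at most `G`. -/
theorem filter_h_le {T : ℕ} {G : ℝ} {g : ℕ → Vec d} (hτ : 0 < τ) (h0 : F 0 = ⟨τ, 0⟩)
    (hF : ∀ t, F (t + 1) = filterStep k (F t) (gt t)) (hg : ∀ t < T, ‖g t‖ ≤ G)
    (hB : ((bigRounds T G g gt).card : ℝ) ≤ k) {t : ℕ} (ht : t ≤ T) :
    (F t).h ≤ 4 * max τ G := by
  induction t with
  | zero => rw [h0]; simp only; have := le_max_left τ G; linarith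
  | succ t ih =>
    specialize ih (by omega)
    rcases filter_step_cases hτ h0 hF t with ⟨h1, h2, e, -⟩ | ⟨-, -, e, -⟩ | ⟨-, e, -⟩ <;> rw [e]
    · obtain ⟨E, hE, hc, hh⟩ := filter_witnesses hτ h0 hF t
      have hcard : (bigRounds T G g gt).card < (insert t E).card := by
        rw [Finset.card_insert_of_notMem (fun h => by simpa using hE h), hc]
        exact_mod_cast hB.trans_lt h2
      obtain ⟨i, hi, hiB⟩ := Finset.exists_mem_notMem_of_card_lt_card hcard
      have hit : i < T := by
        rcases Finset.mem_insert.1 hi with rfl | hi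
        · omega
        · have := Finset.mem_range.1 (hE hi); omega
      have hhi : (F t).h ≤ ‖gt i‖ := by
        rcases Finset.mem_insert.1 hi with rfl | hi
        · exact h1
        · exact hh i hi
      have h3 : ‖g i - gt i‖ ≤ G := by
        simpa [bigRounds, hit] using hiB
      have h4 : ‖gt i‖ ≤ ‖g i‖ + ‖g i - gt i‖ := by
        calc ‖gt i‖ = ‖g i - (g i - gt i)‖ := by congr 1; abel
          _ ≤ _ := norm_sub_le _ _
      have := hg i hit
      have := le_max_right τ G
      simp only
      linarith
    · exact ih
    · exact ih

theorem norm_clip_le {h : ℝ} (hh : 0 < h) (x : Vec d) : ‖clip h x‖ ≤ h := by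
  rw [clip, norm_smul, Real.norm_of_nonneg (by positivity)]
  rcases (norm_nonneg x).eq_or_lt with h0 | h0
  · rw [← h0]; simp; exact hh.le
  · calc min 1 (h / ‖x‖) * ‖x‖ ≤ h / ‖x‖ * ‖x‖ := by gcongr; exact min_le_right _ _
      _ = h := by field_simp

theorem norm_clip_le_norm {h : ℝ} (hh : 0 < h) (x : Vec d) : ‖clip h x‖ ≤ ‖x‖ := by
  rw [clip, norm_smul, Real.norm_of_nonneg (by positivity)]
  calc min 1 (h / ‖x‖) * ‖x‖ ≤ 1 * ‖x‖ := by gcongr; exact min_le_left _ _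
    _ = ‖x‖ := one_mul _

theorem clip_eq_self {h : ℝ} {x : Vec d} (hx : ‖x‖ < h) : clip h x = x := by
  rw [clip]
  rcases (norm_nonneg x).eq_or_lt with h0 | h0
  · rw [norm_eq_zero.1 h0.symm]; simp
  · rw [min_eq_left, one_smul]
    rw [le_div_iff₀ h0]; linarith

/-- The error of the clipped gradients, split into a part of total size `O(k [G])` up to the number
of thresholds, and a part that lives on the rounds that change the threshold. -/
theorem exists_clip_error {T : ℕ} {G : ℝ} {g : ℕ → Vec d} (hk : 0 ≤ k) (hτ : 0 < τ)
    (h0 : F 0 = ⟨τ, 0⟩)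
    (hF : ∀ t, F (t + 1) = filterStep k (F t) (gt t)) (hg : ∀ t < T, ‖g t‖ ≤ G)
    (hB : CorruptionBounded T k G g gt) :
    ∃ e : ℕ → ℝ, (∀ t, 0 ≤ e t) ∧
      ∑ t ∈ Finset.range T, e t
        ≤ 9 * max τ G * k * (∑ t ∈ Finset.range T, doubled F t + 1) ∧
      ∀ t < T, ‖g t - clip (F t).h (gt t)‖ ≤ e t + 3 * max τ G * doubled F t := by
  classical
  set M := max τ G with hM
  have hτM : τ ≤ M := le_max_left _ _
  have hGM : G ≤ M := le_max_right _ _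
  have hM0 : 0 < M := hτ.trans_le hτM
  set D := ∑ t ∈ Finset.range T, doubled F t with hD
  have hD0 : 0 ≤ D := Finset.sum_nonneg fun t _ => doubled_nonneg F t
  set B := bigRounds T G g gt with hBdef
  have hd1 : ∀ t, doubled F t ≤ 1 := fun t => by unfold doubled; split_ifs <;> norm_num
  -- rounds with large corruption, the remaining corruption, and rounds with a clipped gradient
  -- that do not change the threshold
  set c1 : ℕ → ℝ := fun t => if t ∈ B then 5 * M else 0 with hc1
  set c2 : ℕ → ℝ := fun t => if t ∈ Finset.range T \ B then ‖g t - gt t‖ else 0 with hc2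
  set c3 : ℕ → ℝ := fun t => 3 * M * (if (F t).h ≤ ‖gt t‖ then 1 - doubled F t else 0) with hc3
  have n1 : ∀ t, 0 ≤ c1 t := fun t => by simp only [hc1]; split_ifs <;> positivity
  have n2 : ∀ t, 0 ≤ c2 t := fun t => by simp only [hc2]; split_ifs <;> positivity
  have n3 : ∀ t, 0 ≤ c3 t := fun t => by
    simp only [hc3]
    have := hd1 t
    refine mul_nonneg (by positivity) ?_
    split_ifs <;> linarith
  refine ⟨fun t => c1 t + c2 t + c3 t,
    fun t => add_nonneg (add_nonneg (n1 t) (n2 t)) (n3 t), ?_, ?_⟩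
  · rw [Finset.sum_add_distrib, Finset.sum_add_distrib]
    have hBsub : B ⊆ Finset.range T := Finset.filter_subset _ _
    have s1 : ∑ t ∈ Finset.range T, c1 t ≤ 5 * M * k := by
      rw [← Finset.sum_filter, Finset.filter_mem_eq_inter, Finset.inter_eq_right.2 hBsub,
        Finset.sum_const, nsmul_eq_mul]
      have := hB.1
      nlinarith
    have s2 : ∑ t ∈ Finset.range T, c2 t ≤ k * M := by
      rw [← Finset.sum_filter, Finset.filter_mem_eq_inter,
        Finset.inter_eq_right.2 Finset.sdiff_subset]
      exact hB.2.trans (by gcongr)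
    have s3 : ∑ t ∈ Finset.range T, c3 t ≤ 3 * M * (k * (D + 1)) := by
      rw [← Finset.mul_sum]
      have := sum_clipped_le hk hτ h0 hF T
      gcongr
    have : 0 ≤ M * k * D := by positivity
    linarith
  · intro t ht
    have hpos := filter_h_pos hτ h0 hF t
    have hn := norm_sub_le (g t) (clip (F t).h (gt t))
    have hgt := hg t ht
    have hdn := doubled_nonneg F t
    have hdM : 0 ≤ 3 * M * doubled F t := by positivity
    by_cases htB : t ∈ B
    · have e1 : c1 t = 5 * M := if_pos htB
      have := norm_clip_le hpos (gt t)
      have := filter_h_le hτ h0 hF hg hB.1 ht.le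
      linarith [n2 t, n3 t]
    · have e2 : c2 t = ‖g t - gt t‖ := if_pos (by simp [ht, htB])
      rcases lt_or_ge ‖gt t‖ (F t).h with h1 | h1
      · rw [clip_eq_self h1]
        linarith [n1 t, n3 t]
      · have e3 : c3 t = 3 * M * (1 - doubled F t) := by simp only [hc3, if_pos h1]
        have h3 : ‖g t - gt t‖ ≤ G := by
          simpa [hBdef, bigRounds, ht] using htB
        have h4 : ‖gt t‖ ≤ ‖g t‖ + ‖g t - gt t‖ := by
          calc ‖gt t‖ = ‖g t - (g t - gt t)‖ := by congr 1; abel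
            _ ≤ _ := norm_sub_le _ _
        have := norm_clip_le_norm hpos (gt t)
        linarith [n1 t, n2 t]

end Filter

/-! ### The tracker -/

section Tracker

variable {d : ℕ} {τ γβ : ℝ} {K : ℕ → TrackerState} {w : ℕ → Vec d}

theorem tracker_z_pos (hτ : 0 < τ) (h0 : K 0 = ⟨τ, 0⟩)
    (hK : ∀ t, K (t + 1) = trackerStep (K t) (w t)) (t : ℕ) : 0 < (K t).z := by
  induction t with
  | zero => rw [h0]; exact hτ
  | succ t ih =>
    rw [hK, trackerStep]
    split_ifs with h
    · simp only; linarith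
    · exact ih

theorem tracker_step_cases (hτ : 0 < τ) (h0 : K 0 = ⟨τ, 0⟩)
    (hK : ∀ t, K (t + 1) = trackerStep (K t) (w t)) (γβ : ℝ) (t : ℕ) :
    ((K t).z ≤ ‖w t‖ ∧ K (t + 1) = ⟨2 * ‖w t‖, (K t).m + 1⟩ ∧
      betaWeight γβ (K t) (K (t + 1)) = γβ / (1 + ((K t).m + 1))) ∨
      (‖w t‖ < (K t).z ∧ K (t + 1) = K t ∧ betaWeight γβ (K t) (K (t + 1)) = 0) := by
  have hpos := tracker_z_pos hτ h0 hK t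
  by_cases h1 : (K t).z ≤ ‖w t‖
  · left
    have e : K (t + 1) = ⟨2 * ‖w t‖, (K t).m + 1⟩ := by rw [hK, trackerStep, if_pos h1]
    refine ⟨h1, e, ?_⟩
    rw [betaWeight, e, if_pos]
    · push_cast; rfl
    · simp only; linarith
  · right
    have e : K (t + 1) = K t := by rw [hK, trackerStep, if_neg h1]
    exact ⟨not_le.1 h1, e, by rw [betaWeight, e]; simp⟩

theorem betaWeight_nonneg (hγ : 0 ≤ γβ) (s s' : TrackerState) : 0 ≤ betaWeight γβ s s' := by
  unfold betaWeight; split_ifs <;> positivity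

theorem betaWeight_le (hγ : 0 ≤ γβ) (s s' : TrackerState) : betaWeight γβ s s' ≤ γβ := by
  unfold betaWeight
  split_ifs
  · exact div_le_self hγ (by linarith [Nat.cast_nonneg (α := ℝ) s'.m])
  · exact hγ

/-- The weights `β_t` are a harmonic sum over the changes of the tracker. -/
theorem sum_betaWeight_le (hγ : 0 ≤ γβ) (hτ : 0 < τ) (h0 : K 0 = ⟨τ, 0⟩)
    (hK : ∀ t, K (t + 1) = trackerStep (K t) (w t)) (T : ℕ) :
    ∑ t ∈ Finset.range T, betaWeight γβ (K t) (K (t + 1)) ≤ γβ * Real.log (1 + T) := by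
  suffices h : (K T).m ≤ T ∧ ∑ t ∈ Finset.range T, betaWeight γβ (K t) (K (t + 1))
      ≤ γβ * Real.log (1 + (K T).m) by
    refine h.2.trans ?_
    have := h.1
    gcongr
  induction T with
  | zero => simp [h0]
  | succ T ih =>
    rw [Finset.sum_range_succ]
    rcases tracker_step_cases hτ h0 hK γβ T with ⟨-, e, e'⟩ | ⟨-, e, e'⟩ <;> rw [e'] <;> rw [e]
    · refine ⟨by simp only; omega, ?_⟩
      push_cast
      have hm : (0:ℝ) ≤ (K T).m := Nat.cast_nonneg _
      have h1 := Real.one_sub_inv_le_log_of_pos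
        (show (0:ℝ) < (1 + ((K T).m + 1)) / (1 + (K T).m) by positivity)
      rw [Real.log_div (by positivity) (by positivity)] at h1
      have e2 : 1 - ((1 + ((K T).m + 1)) / (1 + (K T).m) : ℝ)⁻¹ = 1 / (1 + ((K T).m + 1)) := by
        field_simp; ring
      rw [e2] at h1
      have h2 := mul_le_mul_of_nonneg_left h1 hγ
      have e3 : γβ * (1 / (1 + (((K T).m : ℝ) + 1))) = γβ / (1 + ((K T).m + 1)) := by ring
      linarith [ih.2]
    · exact ⟨by omega, by linarith [ih.2]⟩

theorem norm_le_tracker (hτ : 0 < τ) (h0 : K 0 = ⟨τ, 0⟩)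
    (hK : ∀ t, K (t + 1) = trackerStep (K t) (w t)) (T : ℕ) :
    ∀ t < T, ‖w t‖ ≤ (K T).z := by
  induction T with
  | zero => simp
  | succ T ih =>
    intro t ht
    rcases tracker_step_cases hτ h0 hK 0 T with ⟨h, e, -⟩ | ⟨h, e, -⟩ <;> rw [e]
    · simp only
      rcases Nat.lt_succ_iff_lt_or_eq.1 ht with h1 | rfl
      · linarith [ih t h1, norm_nonneg (w T)]
      · linarith [norm_nonneg (w t)]
    · rcases Nat.lt_succ_iff_lt_or_eq.1 ht with h1 | rfl
      · exact ih t h1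
      · exact h.le

/-- The level after `m` changes is at least `2 ^ m τ`. If it is not the initial one, it is twice
the norm of a play that was penalized with weight `γβ / (1 + m)`. -/
theorem tracker_witness (hτ : 0 < τ) (h0 : K 0 = ⟨τ, 0⟩)
    (hK : ∀ t, K (t + 1) = trackerStep (K t) (w t)) (γβ : ℝ) (T : ℕ) :
    τ * 2 ^ (K T).m ≤ (K T).z ∧
      (K T = ⟨τ, 0⟩ ∨ ∃ s < T, (K T).z = 2 * ‖w s‖ ∧
        betaWeight γβ (K s) (K (s + 1)) = γβ / (1 + (K T).m)) := by
  induction T with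
  | zero => simp [h0]
  | succ T ih =>
    rcases tracker_step_cases hτ h0 hK γβ T with ⟨h, e, e'⟩ | ⟨-, e, -⟩
    · refine ⟨?_, Or.inr ⟨T, by omega, by rw [e], ?_⟩⟩
      · rw [e]
        simp only [pow_succ]
        linarith [ih.1]
      · rw [e', e]; push_cast; rfl
    · rw [e]
      refine ⟨ih.1, ih.2.imp id ?_⟩
      rintro ⟨s, hs, h1, h2⟩
      exact ⟨s, by omega, h1, h2⟩

theorem tracker_m_le (hτ : 0 < τ) (h0 : K 0 = ⟨τ, 0⟩)
    (hK : ∀ t, K (t + 1) = trackerStep (K t) (w t)) {T : ℕ} {N : ℝ} (hN : 0 ≤ N)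
    (hw : ∀ t < T, ‖w t‖ ≤ N) : ((K T).m : ℝ) ≤ 2 * Real.log (1 + 2 / τ * N) := by
  have hlog : 0 ≤ Real.log (1 + 2 / τ * N) := Real.log_nonneg (by
    have : 0 ≤ 2 / τ * N := by positivity
    linarith)
  obtain ⟨h1, h2 | ⟨s, hs, h2, -⟩⟩ := tracker_witness hτ h0 hK 1 T
  · rw [h2]; simp only [Nat.cast_zero]; linarith
  · have h3 : (2 : ℝ) ^ (K T).m ≤ 1 + 2 / τ * N := by
      have h4 : τ * 2 ^ (K T).m ≤ 2 * N := by linarith [hw s hs]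
      have h5 : (2 : ℝ) ^ (K T).m ≤ 2 / τ * N := by
        rw [div_mul_eq_mul_div, le_div_iff₀ hτ]; linarith
      linarith
    have h6 := Real.log_le_log (by positivity) h3
    rw [Real.log_pow] at h6
    have h7 : (0:ℝ) ≤ (K T).m := Nat.cast_nonneg _
    nlinarith [Real.log_two_gt_d9]

/-- A linear loss in the level of the tracker is paid for by the quadratic penalty at its last
change, or is small because the level is still the initial one. -/
theorem mul_tracker_le (hγ : 0 < γβ) (hτ : 0 < τ) (h0 : K 0 = ⟨τ, 0⟩)
    (hK : ∀ t, K (t + 1) = trackerStep (K t) (w t)) (T : ℕ) {E : ℝ} (hE : 0 ≤ E) :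
    E * (K T).z ≤ E * τ + ∑ t ∈ Finset.range T, betaWeight γβ (K t) (K (t + 1)) * ‖w t‖ ^ 2
      + E ^ 2 / γβ * (1 + (K T).m) := by
  have hnn : ∀ t ∈ Finset.range T, 0 ≤ betaWeight γβ (K t) (K (t + 1)) * ‖w t‖ ^ 2 :=
    fun t _ => mul_nonneg (betaWeight_nonneg hγ.le _ _) (sq_nonneg _)
  have hm : (0:ℝ) ≤ (K T).m := Nat.cast_nonneg _
  have hlast : 0 ≤ E ^ 2 / γβ * (1 + (K T).m) := by positivity
  obtain ⟨-, h2 | ⟨s, hs, h2, h3⟩⟩ := tracker_witness hτ h0 hK γβ T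
  · have : (K T).z = τ := by rw [h2]
    rw [this]
    linarith [Finset.sum_nonneg hnn]
  · have h4 := Finset.single_le_sum hnn (Finset.mem_range.2 hs)
    rw [h3] at h4
    have h5 : E * (2 * ‖w s‖) ≤ γβ / (1 + (K T).m) * ‖w s‖ ^ 2 + E ^ 2 / γβ * (1 + (K T).m) := by
      have e : γβ / (1 + (K T).m) * ‖w s‖ ^ 2 + E ^ 2 / γβ * (1 + (K T).m) - E * (2 * ‖w s‖)
          = (γβ * ‖w s‖ - E * (1 + (K T).m)) ^ 2 / (γβ * (1 + (K T).m)) := by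
        field_simp; ring
      have : 0 ≤ (γβ * ‖w s‖ - E * (1 + (K T).m)) ^ 2 / (γβ * (1 + (K T).m)) := by positivity
      linarith
    rw [h2]
    have : 0 ≤ E * τ := by positivity
    linarith

end Tracker

/-! ### Regret of the learners of the coordinates -/

/-- Regret of gradient descent for the direction with coin betting for the magnitude: the slopes
of the latter are those of the former, projected to the direction played. -/
theorem magnitude_direction_regret {d : ℕ} {sm : ℕ → CoinState} {sd : ℕ → DirState d}
    {v : ℕ → Vec d} {B : ℕ → ℝ} {W : ℝ} (hW : 0 < W) (hB : ∀ t, 0 < B t)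
    (hm0 : sm 0 = ⟨W, 0, B 0 ^ 2⟩) (hd0 : sd 0 = ⟨0, 0⟩) (hv : ∀ t, ‖v t‖ ≤ B t)
    (hm : ∀ t, sm (t + 1) = (sm t).step (B t) (inner ℝ (v t) (sd t).dir))
    (hd : ∀ t, sd (t + 1) = (sd t).step (v t)) {T : ℕ} {b Λ : ℝ} (u : Vec d) (hb0 : 0 < b)
    (hBb : B 0 ≤ b) (hb : ∀ t < T, B t ≤ b)
    (hΛ : 1 + Real.log (1 + ‖u‖ * T * b / W) + 5 / 4 * Real.log (1 + 4 * T * b ^ 2 / B 0 ^ 2) ≤ Λ)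
    (hΛ0 : 0 ≤ Λ) :
    ∑ t ∈ Finset.range T, inner ℝ (v t) ((sm t).bet (B t) • (sd t).dir - u) ≤
      W + ‖u‖ * ((3 + 2 * √Λ) * √(∑ t ∈ Finset.range T, ‖v t‖ ^ 2) + 2 * b * Λ) := by
  set Q := ∑ t ∈ Finset.range T, ‖v t‖ ^ 2
  have hθ := dirState_norm_le hd0 hd
  have hσ : ∀ t, |inner ℝ (v t) (sd t).dir| ≤ ‖v t‖ := fun t => by
    calc _ ≤ ‖v t‖ * ‖(sd t).dir‖ := abs_real_inner_le_norm _ _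
      _ ≤ ‖v t‖ * 1 := by have := hθ t; gcongr
      _ = _ := mul_one _
  have hcoin := coin_regret (s := sm) (σ := fun t => inner ℝ (v t) (sd t).dir) hW hB hm0
    (fun t => (hσ t).trans (hv t)) hm hb0 hBb hb (norm_nonneg u) hΛ
  -- the direction of `u`, which is `0` for `u = 0`
  set û : Vec d := ‖u‖⁻¹ • u with hu'
  have hû : ‖û‖ ≤ 1 := by
    rw [hu', norm_smul, norm_inv, norm_norm]
    exact inv_mul_le_one
  have hue : ‖u‖ • û = u := by
    rcases eq_or_ne u 0 with h | h
    · rw [hu', h]; simp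
    · rw [hu', smul_smul, mul_inv_cancel₀ (norm_ne_zero_iff.2 h), one_smul]
  have hdir := dir_regret hd0 hd T hû
  have hdec : ∑ t ∈ Finset.range T, inner ℝ (v t) ((sm t).bet (B t) • (sd t).dir - u)
      = ∑ t ∈ Finset.range T, inner ℝ (v t) (sd t).dir * ((sm t).bet (B t) - ‖u‖)
        + ‖u‖ * ∑ t ∈ Finset.range T, inner ℝ (v t) ((sd t).dir - û) := by
    rw [Finset.mul_sum, ← Finset.sum_add_distrib]
    refine Finset.sum_congr rfl fun t _ => ?_
    nth_rewrite 1 [← hue]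
    simp only [inner_sub_right, inner_smul_right]
    ring
  rw [hdec]
  have hQ : √(∑ t ∈ Finset.range T, (inner ℝ (v t) (sd t).dir : ℝ) ^ 2) ≤ √Q := by
    refine Real.sqrt_le_sqrt (Finset.sum_le_sum fun t _ => ?_)
    rw [← sq_abs]
    exact pow_le_pow_left₀ (abs_nonneg _) (hσ t) 2
  have h1 := mul_le_mul_of_nonneg_left hdir (norm_nonneg u)
  have h0 : 0 ≤ ‖u‖ * (2 * √Λ * √Q + 2 * b * Λ) := by positivity
  rcases hcoin with h | ⟨h, hs⟩
  · linarith
  · have h2 : 2 * √(∑ t ∈ Finset.range T, (inner ℝ (v t) (sd t).dir : ℝ) ^ 2) * √Λ + 2 * b * Λ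
        ≤ 2 * √Λ * √Q + 2 * b * Λ := by
      have := mul_le_mul_of_nonneg_right hQ (Real.sqrt_nonneg Λ)
      linarith
    have h3 := mul_le_mul_of_nonneg_left (hs.trans h2) (norm_nonneg u)
    linarith

/-- Regret in the extra coordinate. Squares of the slopes `a_t - n_t` are at most
`γ a_t + O(γ) n_t`, hence linear in the slopes; so the variation in the coin-betting bound
is controlled by the sum of the slopes, which is what the bound estimates, and by `∑ a_t`.
No term of order `γ √T` arises. -/
theorem extra_regret {s : ℕ → CoinState} {a n : ℕ → ℝ} {γ W : ℝ} (hW : 0 < W) (hγ : 0 < γ)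
    (h0 : s 0 = ⟨W, 0, (3 * γ) ^ 2⟩) (ha : ∀ t, 0 ≤ a t) (haγ : ∀ t, a t ≤ γ)
    (hn : ∀ t, 0 ≤ n t) (hnγ : ∀ t, n t ≤ 3 / 2 * γ)
    (hs : ∀ t, s (t + 1) = (s t).step (3 * γ) (a t - n t)) {T : ℕ} {Y Λ : ℝ} (hY : 0 ≤ Y)
    (hΛ : 1 + Real.log (1 + Y * T * (3 * γ) / W)
      + 5 / 4 * Real.log (1 + 4 * T * (3 * γ) ^ 2 / (3 * γ) ^ 2) ≤ Λ) (hΛ0 : 0 ≤ Λ) :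
    ∑ t ∈ Finset.range T, (a t - n t) * ((s t).bet (3 * γ) - Y) ≤
      W + Y * (∑ t ∈ Finset.range T, a t + 16 * γ * Λ) := by
  set A := ∑ t ∈ Finset.range T, a t with hA
  have hA0 : 0 ≤ A := Finset.sum_nonneg fun t _ => ha t
  have hγ3 : 0 < 3 * γ := by positivity
  have hbound : 0 ≤ Y * (A + 16 * γ * Λ) := by positivity
  have hcoin := coin_regret (s := s) (B := fun _ => 3 * γ) (σ := fun t => a t - n t) hW
    (fun _ => hγ3) h0
    (fun t => abs_le.2 ⟨by linarith [ha t, hnγ t], by linarith [haγ t, hn t]⟩) hs (b := 3 * γ) hγ3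
    le_rfl (fun _ _ => le_rfl) hY hΛ
  rcases hcoin with h | ⟨h, hS⟩
  · linarith
  refine h.trans ?_
  set S := -∑ t ∈ Finset.range T, (a t - n t) with hSdef
  set V := ∑ t ∈ Finset.range T, (a t - n t) ^ 2 with hV
  have hV0 : 0 ≤ V := Finset.sum_nonneg fun _ _ => sq_nonneg _
  have hVle : V ≤ 5 / 2 * γ * A + 3 / 2 * γ * S := by
    have e : 5 / 2 * γ * A + 3 / 2 * γ * S
        = ∑ t ∈ Finset.range T, (γ * a t + 3 / 2 * γ * n t) := by
      rw [hSdef, Finset.sum_sub_distrib, Finset.sum_add_distrib, ← Finset.mul_sum,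
        ← Finset.mul_sum]
      ring
    rw [e]
    refine Finset.sum_le_sum fun t _ => ?_
    nlinarith [mul_nonneg (ha t) (hn t), mul_nonneg (ha t) (sub_nonneg.2 (haγ t)),
      mul_nonneg (hn t) (sub_nonneg.2 (hnγ t))]
  have hamgm : 2 * √V * √Λ ≤ V / (4 * γ) + 4 * γ * Λ := by
    have e1 : V = √V ^ 2 := (Real.sq_sqrt hV0).symm
    have e2 : Λ = √Λ ^ 2 := (Real.sq_sqrt hΛ0).symm
    have e3 : V / (4 * γ) + 4 * γ * Λ - 2 * √V * √Λ = (√V - 4 * γ * √Λ) ^ 2 / (4 * γ) := by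
      nth_rewrite 1 [e1]
      nth_rewrite 1 [e2]
      field_simp
      ring
    have : 0 ≤ (√V - 4 * γ * √Λ) ^ 2 / (4 * γ) := by positivity
    linarith
  have h4 : V / (4 * γ) ≤ 5 / 8 * A + 3 / 8 * S := by
    rw [div_le_iff₀ (by positivity)]
    linarith
  have hS2 : S ≤ A + 16 * γ * Λ := by linarith
  have := mul_le_mul_of_nonneg_left hS2 hY
  linarith

/-! ### Runs of the algorithm -/

/-- The range of the parameters. -/
structure Params.Valid (P : Params) : Prop where
  T : 3 ≤ P.T
  k : 0 ≤ P.k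
  ε : 0 < P.ε
  c : 0 < P.c
  γα : 0 < P.γα
  γβ : 0 < P.γβ
  τG : 0 < P.τG
  τD : 0 < P.τD

namespace Params.Valid

variable {P : Params}

theorem one_lt_p (hP : P.Valid) : 1 < P.p := by
  have h3 : (3 : ℝ) ≤ P.T := by exact_mod_cast hP.T
  rw [Params.p, Real.lt_log_iff_exp_lt (by linarith)]
  linarith [Real.exp_one_lt_d9]

theorem α_pos (hP : P.Valid) : 0 < P.α := div_pos (mul_pos hP.ε hP.τG) hP.c

theorem γ_pos (hP : P.Valid) : 0 < P.γ := add_pos hP.γα hP.γβ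

end Params.Valid

section Run

variable {d : ℕ} (P : Params) (gt : ℕ → Vec d)

/-- The state before round `t`. -/
def run (t : ℕ) : AlgState (epigraphAlgorithm d P) := algState P (epigraphAlgorithm d P) gt t

/-- The state of the base algorithm before round `t`. -/
def runBase (t : ℕ) : EpiState d := (run P gt t).base

/-- The filter's threshold in round `t`. -/
def runH (t : ℕ) : ℝ := (run P gt t).filter.h

/-- The play in round `t`. -/
def runPlay (t : ℕ) : Vec d := play P (epigraphAlgorithm d P) gt t

/-- The quadratic weight `a_t`. -/
def runWeight (t : ℕ) : ℝ :=
  alphaWeight P.γα (run P gt t).filter (run P gt (t + 1)).filter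
    + betaWeight P.γβ (run P gt t).tracker (run P gt (t + 1)).tracker

/-- The unprojected point `(x_t, y_t)`. -/
def runPoint (t : ℕ) : Vec d × ℝ := (runBase P gt t).point P (runH P gt t)

/-- The projected point `(w_t, ŷ_t)`. -/
def runProj (t : ℕ) : Vec d × ℝ := epiProj (runH P gt t) P.γ (runPoint P gt t)

/-- The clipped gradient. -/
def runClip (t : ℕ) : Vec d := clip (runH P gt t) (gt t)

/-- The Huber regularizer `f_t`. -/
def runHuber (t : ℕ) : Vec d → ℝ := huber P.c P.p P.α (run P gt (t + 1)).S (runPlay P gt t)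

/-- The dual norm `ρ_t` of `(gc_t, a_t)`. -/
def runRho (t : ℕ) : ℝ :=
  √(‖runClip P gt t‖ ^ 2 / runH P gt t ^ 2 + runWeight P gt t ^ 2 / P.γ ^ 2)

/-- The distance `D_t` of `(x_t, y_t)` to the epigraph. -/
def runDist (t : ℕ) : ℝ := augNorm (runH P gt t) P.γ (runPoint P gt t - runProj P gt t)

/-- The slope `v_t` for the learner of the first `d` coordinates. -/
def runV (t : ℕ) : Vec d :=
  runClip P gt t + gradient (runHuber P gt t) (runPlay P gt t)
    + (runRho P gt t * runH P gt t ^ 2 / runDist P gt t)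
      • ((runPoint P gt t).1 - (runProj P gt t).1)

/-- The decrease of the slope of the extra coordinate that is due to the distance to the
epigraph: `b_t = a_t - n_t`. -/
def runN (t : ℕ) : ℝ :=
  runRho P gt t * P.γ ^ 2 / runDist P gt t * ((runProj P gt t).2 - (runPoint P gt t).2)

/-- The norm of the gradient of the Huber regularizer at the play, divided by `c p`. -/
def runR (t : ℕ) : ℝ :=
  ‖runPlay P gt t‖ ^ (P.p - 1) / ((run P gt (t + 1)).S + P.α ^ P.p) ^ (1 - 1 / P.p)

/-- The `ℓ^p` norm of the norms of the plays and of `α`. -/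
def runTotal : ℝ := ((run P gt P.T).S + P.α ^ P.p) ^ (1 / P.p)

theorem run_filter_zero : (run P gt 0).filter = ⟨P.τG, 0⟩ := rfl

theorem run_filter_succ (t : ℕ) :
    (run P gt (t + 1)).filter = filterStep P.k (run P gt t).filter (gt t) := rfl

theorem run_tracker_zero : (run P gt 0).tracker = ⟨P.τD, 0⟩ := rfl

theorem run_tracker_succ (t : ℕ) :
    (run P gt (t + 1)).tracker = trackerStep (run P gt t).tracker (runPlay P gt t) := rfl

theorem runProj_fst (t : ℕ) : (runProj P gt t).1 = runPlay P gt t := rfl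

theorem run_S (T : ℕ) :
    (run P gt T).S = ∑ t ∈ Finset.range T, ‖runPlay P gt t‖ ^ P.p := by
  induction T with
  | zero => rfl
  | succ T ih => rw [Finset.sum_range_succ, ← ih]; rfl

theorem runBase_mag_succ (t : ℕ) :
    (runBase P gt (t + 1)).mag = (runBase P gt t).mag.step (slopeBound P (runH P gt t))
      (inner ℝ (runV P gt t) (runBase P gt t).dir.dir) := rfl

theorem runBase_dir_succ (t : ℕ) :
    (runBase P gt (t + 1)).dir = (runBase P gt t).dir.step (runV P gt t) := rfl

theorem runBase_extra_succ (t : ℕ) :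
    (runBase P gt (t + 1)).extra
      = (runBase P gt t).extra.step (3 * P.γ) (runWeight P gt t - runN P gt t) := by
  have e : runWeight P gt t - runN P gt t = runWeight P gt t
      + runRho P gt t * P.γ ^ 2 / runDist P gt t * ((runPoint P gt t).2 - (runProj P gt t).2) := by
    rw [runN]; ring
  rw [e]
  rfl

theorem runRho_nonneg (t : ℕ) : 0 ≤ runRho P gt t := Real.sqrt_nonneg _

theorem run_S_nonneg (t : ℕ) : 0 ≤ (run P gt t).S := by
  rw [run_S]
  positivity

variable {P}

theorem runH_pos (hP : P.Valid) (t : ℕ) : 0 < runH P gt t :=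
  filter_h_pos (F := fun t => (run P gt t).filter) hP.τG (run_filter_zero P gt)
    (run_filter_succ P gt) t

theorem runWeight_nonneg (hP : P.Valid) (t : ℕ) : 0 ≤ runWeight P gt t := by
  refine add_nonneg ?_ (betaWeight_nonneg hP.γβ.le _ _)
  have := hP.γα
  unfold alphaWeight
  split_ifs <;> positivity

theorem runWeight_le (hP : P.Valid) (t : ℕ) : runWeight P gt t ≤ P.γ := by
  refine add_le_add ?_ (betaWeight_le hP.γβ.le _ _)
  have := hP.γα
  unfold alphaWeight
  split_ifs
  · exact le_rfl
  · exact this.le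

theorem runRho_le (hP : P.Valid) (t : ℕ) : runRho P gt t ≤ 3 / 2 := by
  rw [runRho, Real.sqrt_le_left (by norm_num)]
  have hh := runH_pos gt hP t
  have h1 : ‖runClip P gt t‖ ^ 2 / runH P gt t ^ 2 ≤ 1 := by
    rw [div_le_one (by positivity)]
    exact pow_le_pow_left₀ (norm_nonneg _) (norm_clip_le hh _) 2
  have h2 : runWeight P gt t ^ 2 / P.γ ^ 2 ≤ 1 := by
    rw [div_le_one (pow_pos hP.γ_pos 2)]
    exact pow_le_pow_left₀ (runWeight_nonneg gt hP t) (runWeight_le gt hP t) 2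
  linarith

theorem isEpiProj_runProj (hP : P.Valid) (t : ℕ) :
    IsEpiProj (runH P gt t) P.γ (runPoint P gt t) (runProj P gt t) :=
  isEpiProj_epiProj (runH_pos gt hP t) hP.γ_pos _

theorem runN_nonneg (hP : P.Valid) (t : ℕ) : 0 ≤ runN P gt t := by
  have h1 := (isEpiProj_runProj gt hP t).snd_le hP.γ_pos
  have h2 := runRho_nonneg P gt t
  have h3 : 0 ≤ runDist P gt t := augNorm_nonneg _ _ _
  exact mul_nonneg (by positivity) (by linarith)

theorem runN_le (hP : P.Valid) (t : ℕ) : runN P gt t ≤ 3 / 2 * P.γ := by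
  have h1 := abs_correction_snd_le (h := runH P gt t) hP.γ_pos (runRho_nonneg P gt t)
    (runPoint P gt t - runProj P gt t)
  have e : runN P gt t = -(runRho P gt t * P.γ ^ 2
      / augNorm (runH P gt t) P.γ (runPoint P gt t - runProj P gt t)
        * (runPoint P gt t - runProj P gt t).2) := by
    rw [runN, runDist, Prod.snd_sub]; ring
  rw [e]
  have h2 := (abs_le.1 h1).1
  have h3 := mul_le_mul_of_nonneg_right (runRho_le gt hP t) hP.γ_pos.le
  linarith

theorem rpow_play_le (hP : P.Valid) (t : ℕ) :
    ‖runPlay P gt t‖ ^ P.p ≤ (run P gt (t + 1)).S + P.α ^ P.p := by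
  have h1 := run_S_nonneg P gt t
  have h2 := Real.rpow_pos_of_pos hP.α_pos P.p
  rw [run_S, Finset.sum_range_succ, ← run_S]
  linarith

theorem runR_nonneg (hP : P.Valid) (t : ℕ) : 0 ≤ runR P gt t := by
  have h1 := run_S_nonneg P gt (t + 1)
  have h2 := Real.rpow_pos_of_pos hP.α_pos P.p
  unfold runR
  positivity

theorem runR_le_one (hP : P.Valid) (t : ℕ) : runR P gt t ≤ 1 := by
  have h1 := run_S_nonneg P gt (t + 1)
  have h2 := Real.rpow_pos_of_pos hP.α_pos P.p
  exact ratio_rpow_le_one hP.one_lt_p (norm_nonneg _) (rpow_play_le gt hP t) (by linarith)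

theorem norm_runV_le (hP : P.Valid) (t : ℕ) :
    ‖runV P gt t‖ ≤ 5 / 2 * runH P gt t + P.c * P.p * runR P gt t := by
  have hh := runH_pos gt hP t
  have h1 : ‖runClip P gt t‖ ≤ runH P gt t := norm_clip_le hh _
  have h2 : ‖gradient (runHuber P gt t) (runPlay P gt t)‖ = P.c * P.p * runR P gt t :=
    norm_gradient_huber hP.one_lt_p hP.c hP.α_pos (run_S_nonneg P gt _) _
  have h3 := norm_correction_fst_le (γ := P.γ) hh (runRho_nonneg P gt t)
    (runPoint P gt t - runProj P gt t)
  have h4 := mul_le_mul_of_nonneg_right (runRho_le gt hP t) hh.le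
  refine (norm_add₃_le).trans ?_
  rw [h2]
  have h5 : ‖(runRho P gt t * runH P gt t ^ 2 / runDist P gt t)
      • ((runPoint P gt t).1 - (runProj P gt t).1)‖ ≤ runRho P gt t * runH P gt t := h3
  linarith

theorem norm_runV_le_slopeBound (hP : P.Valid) (t : ℕ) :
    ‖runV P gt t‖ ≤ slopeBound P (runH P gt t) := by
  have hh := runH_pos gt hP t
  have hcp : 0 ≤ P.c * P.p := mul_nonneg hP.c.le (by linarith [hP.one_lt_p])
  have := mul_le_mul_of_nonneg_left (runR_le_one gt hP t) hcp
  have := norm_runV_le gt hP t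
  unfold slopeBound
  linarith

theorem slopeBound_pos (hP : P.Valid) (t : ℕ) : 0 < slopeBound P (runH P gt t) := by
  have hh := runH_pos gt hP t
  have hcp : 0 < P.c * P.p := mul_pos hP.c (by linarith [hP.one_lt_p])
  unfold slopeBound
  positivity

/-- The regularized loss of one round, bounded by the linear losses of the coordinates. -/
theorem run_round_le (hP : P.Valid) (t : ℕ) (u : Vec d) :
    inner ℝ (runClip P gt t) (runPlay P gt t - u)
      + P.c * (‖runPlay P gt t‖ ^ P.p / ((run P gt (t + 1)).S + P.α ^ P.p) ^ (1 - 1 / P.p))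
      + runWeight P gt t * ‖runPlay P gt t‖ ^ 2
      ≤ inner ℝ (runV P gt t) ((runPoint P gt t).1 - u)
        + (runWeight P gt t - runN P gt t) * ((runPoint P gt t).2 - ‖u‖ ^ 2)
        + P.c * P.p * ‖u‖ * runR P gt t + runWeight P gt t * ‖u‖ ^ 2 := by
  have hS := run_S_nonneg P gt (t + 1)
  have hp := hP.one_lt_p
  have hc := hP.c
  have hA := Real.rpow_pos_of_pos hP.α_pos P.p
  set κ := P.c * P.p * ‖runPlay P gt t‖ ^ (P.p - 2)
    / ((run P gt (t + 1)).S + P.α ^ P.p) ^ (1 - 1 / P.p) with hκ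
  have hκ0 : 0 ≤ κ := by positivity
  have hgrad : gradient (runHuber P gt t) (runPlay P gt t) = κ • runPlay P gt t :=
    gradient_huber hp _
  have hreg := (isEpiProj_runProj gt hP t).regret_le (runH_pos gt hP t) hP.γ_pos
    (runClip P gt t) hκ0 (a := runWeight P gt t) (ρ := runRho P gt t) rfl u
  have htan := huber_tangent_le (S := (run P gt (t + 1)).S) hp hc hP.α_pos hS
    (runPlay P gt t) u
  have hub := huber_le (S := (run P gt (t + 1)).S) hp hc hP.α_pos hS (runPlay P gt t) u
  change _ + inner ℝ (gradient (runHuber P gt t) (runPlay P gt t)) _ ≤ _ at htan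
  rw [hgrad, ← neg_sub (runPlay P gt t) u, inner_neg_right] at htan
  rw [runProj_fst, ← hgrad] at hreg
  have hV : runClip P gt t + gradient (runHuber P gt t) (runPlay P gt t)
      + (runRho P gt t * runH P gt t ^ 2
        / augNorm (runH P gt t) P.γ (runPoint P gt t - runProj P gt t))
      • ((runPoint P gt t).1 - runPlay P gt t) = runV P gt t := rfl
  rw [hV, hgrad] at hreg
  have hb : runWeight P gt t + runRho P gt t * P.γ ^ 2
        / augNorm (runH P gt t) P.γ (runPoint P gt t - runProj P gt t)
        * ((runPoint P gt t).2 - (runProj P gt t).2) = runWeight P gt t - runN P gt t := by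
    rw [runN, runDist]; ring
  rw [hb] at hreg
  have hmem : ‖runPlay P gt t‖ ^ 2 ≤ (runProj P gt t).2 := (isEpiProj_runProj gt hP t).1
  have h1 := mul_le_mul_of_nonneg_left hmem (runWeight_nonneg gt hP t)
  have h2 : huber P.c P.p P.α (run P gt (t + 1)).S (runPlay P gt t) u
      ≤ P.c * P.p * ‖u‖ * runR P gt t := hub
  linarith

theorem runTotal_pos (hP : P.Valid) : 0 < runTotal P gt := by
  have hS := run_S_nonneg P gt P.T
  have hA := Real.rpow_pos_of_pos hP.α_pos P.p
  unfold runTotal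
  positivity

theorem norm_play_le_runTotal (hP : P.Valid) {t : ℕ} (ht : t < P.T) :
    ‖runPlay P gt t‖ ≤ runTotal P gt := by
  have hA := Real.rpow_pos_of_pos hP.α_pos P.p
  have hp : 0 < P.p := by linarith [hP.one_lt_p]
  have h1 : ‖runPlay P gt t‖ ^ P.p ≤ (run P gt P.T).S + P.α ^ P.p := by
    rw [run_S]
    have := Finset.single_le_sum (f := fun t => ‖runPlay P gt t‖ ^ P.p)
      (fun i _ => by positivity) (Finset.mem_range.2 ht)
    linarith
  calc ‖runPlay P gt t‖ = (‖runPlay P gt t‖ ^ P.p) ^ (1 / P.p) := by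
        rw [← Real.rpow_mul (norm_nonneg _), mul_one_div_cancel hp.ne', Real.rpow_one]
    _ ≤ _ := Real.rpow_le_rpow (by positivity) h1 (by positivity)

/-- The gradients of the regularizer at the plays grow only with the logarithm of the size of
the plays. -/
theorem sum_runR_le (hP : P.Valid) :
    ∑ t ∈ Finset.range P.T, runR P gt t
      ≤ 3 * (1 + P.p * Real.log (1 + 1 / P.α * runTotal P gt)) := by
  have hA := Real.rpow_pos_of_pos hP.α_pos P.p
  have hp : 0 < P.p := by linarith [hP.one_lt_p]
  have hα := hP.α_pos
  have hN := runTotal_pos gt hP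
  have hT : (0:ℝ) < P.T := by exact_mod_cast (by linarith [hP.T] : 0 < P.T)
  have hS := run_S_nonneg P gt P.T
  have h1 : ∀ t ∈ Finset.range P.T, runR P gt t ≤ Real.exp 1 * (1 / P.T
      + ‖runPlay P gt t‖ ^ P.p / ((run P gt (t + 1)).S + P.α ^ P.p)) := fun t _ =>
    ratio_rpow_le hP.T (norm_nonneg _) (by have := run_S_nonneg P gt (t + 1); linarith)
  refine (Finset.sum_le_sum h1).trans ?_
  rw [← Finset.mul_sum, Finset.sum_add_distrib]
  have h2 := sum_div_partial_sum_le hA (x := fun t => ‖runPlay P gt t‖ ^ P.p)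
    (fun t => by positivity) P.T
  simp only [← run_S] at h2
  have h3 : Real.log (((run P gt P.T).S + P.α ^ P.p) / P.α ^ P.p)
      ≤ P.p * Real.log (1 + 1 / P.α * runTotal P gt) := by
    have e1 : (run P gt P.T).S + P.α ^ P.p = runTotal P gt ^ P.p := by
      rw [runTotal, ← Real.rpow_mul (by positivity), one_div_mul_cancel hp.ne', Real.rpow_one]
    rw [e1, ← Real.div_rpow hN.le hα.le, Real.log_rpow (by positivity)]
    refine mul_le_mul_of_nonneg_left (Real.log_le_log (by positivity) ?_) hp.le
    rw [one_div_mul_eq_div]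
    linarith
  have h4 : ∑ _t ∈ Finset.range P.T, 1 / (P.T : ℝ) = 1 := by
    rw [Finset.sum_const, Finset.card_range, nsmul_eq_mul, mul_one_div_cancel hT.ne']
  rw [h4]
  have h5 : 0 ≤ Real.log (1 + 1 / P.α * runTotal P gt) := Real.log_nonneg (by
    have : 0 ≤ 1 / P.α * runTotal P gt := by positivity
    linarith)
  have h6 : Real.exp 1 ≤ 3 := by linarith [Real.exp_one_lt_d9]
  calc _ ≤ Real.exp 1 * (1 + P.p * Real.log (1 + 1 / P.α * runTotal P gt)) := by
        gcongr
        exact h2.trans h3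
    _ ≤ _ := by gcongr

/-- The regularizer at the plays is, up to the factor `c`, at least `N - α`. -/
theorem runTotal_sub_le (hP : P.Valid) :
    runTotal P gt - P.α ≤ ∑ t ∈ Finset.range P.T,
      ‖runPlay P gt t‖ ^ P.p / ((run P gt (t + 1)).S + P.α ^ P.p) ^ (1 - 1 / P.p) := by
  have hA := Real.rpow_pos_of_pos hP.α_pos P.p
  have hp : 0 < P.p := by linarith [hP.one_lt_p]
  have h := le_sum_div_partial_sum_rpow hA hP.one_lt_p (x := fun t => ‖runPlay P gt t‖ ^ P.p)
    (fun t => by positivity) P.T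
  simp only [← run_S] at h
  have e : (P.α ^ P.p) ^ (1 / P.p) = P.α := by
    rw [← Real.rpow_mul hP.α_pos.le, mul_one_div_cancel hp.ne', Real.rpow_one]
  rw [e] at h
  exact h

end Run

/-! ### The regret bound before the logarithms are estimated -/

/-- A logarithm of the magnitude `N` of the plays is absorbed by a linear penalty on `N`. -/
theorem mul_log_le_absorb {A x N c : ℝ} (hA : 0 ≤ A) (hx : 0 ≤ x) (hN : 0 ≤ N) (hc : 0 < c) :
    A * Real.log (1 + x * N) ≤ c / 4 * N + A * Real.log (1 + 4 * A * x / c) := by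
  have hy : 0 < 1 + 4 * A * x / c := by positivity
  have hz : 0 < 1 + x * N := by positivity
  have h1 := Real.log_le_sub_one_of_pos (div_pos hz hy)
  rw [Real.log_div hz.ne' hy.ne'] at h1
  have h2 : A * ((1 + x * N) / (1 + 4 * A * x / c) - 1) ≤ c / 4 * N := by
    have e : (1 + x * N) / (1 + 4 * A * x / c) - 1
        = (x * N - 4 * A * x / c) / (1 + 4 * A * x / c) := by
      rw [div_sub_one hy.ne']; ring
    rw [e, mul_div_assoc', div_le_iff₀ hy]
    have e2 : c / 4 * N * (1 + 4 * A * x / c) = c / 4 * N + A * (x * N) := by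
      field_simp
    rw [e2]
    have : 0 ≤ A * (4 * A * x / c) := by positivity
    have : 0 ≤ c / 4 * N := by positivity
    linarith
  have h3 := mul_le_mul_of_nonneg_left h1 hA
  linarith

section Assembly

variable {d : ℕ} {P : Params} {gt : ℕ → Vec d}

/-- The number of changes of the threshold. -/
def runDoublings (P : Params) (gt : ℕ → Vec d) : ℝ :=
  ∑ t ∈ Finset.range P.T, doubled (fun t => (run P gt t).filter) t

/-- The number of changes of the tracker. -/
def runChanges (P : Params) (gt : ℕ → Vec d) : ℝ := ((run P gt P.T).tracker.m : ℝ)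

/-- The sum of the quadratic weights. -/
def runWeightSum (P : Params) (gt : ℕ → Vec d) : ℝ :=
  ∑ t ∈ Finset.range P.T, runWeight P gt t

theorem runDoublings_nonneg : 0 ≤ runDoublings P gt :=
  Finset.sum_nonneg fun _ _ => doubled_nonneg _ _

theorem runWeight_eq (t : ℕ) : runWeight P gt t
    = P.γα * doubled (fun t => (run P gt t).filter) t
      + betaWeight P.γβ (run P gt t).tracker (run P gt (t + 1)).tracker := by
  rw [runWeight]
  congr 1
  exact alphaWeight_eq P.γα (fun t => (run P gt t).filter) t

theorem runWeightSum_le (hP : P.Valid) :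
    runWeightSum P gt ≤ P.γα * runDoublings P gt + P.γβ * Real.log (1 + P.T) := by
  simp only [runWeightSum, runWeight_eq]
  rw [Finset.sum_add_distrib, ← Finset.mul_sum]
  have := sum_betaWeight_le (K := fun t => (run P gt t).tracker) hP.γβ.le hP.τD
    (run_tracker_zero P gt) (run_tracker_succ P gt) P.T
  unfold runDoublings
  linarith

variable {G : ℝ} {g : ℕ → Vec d}

theorem runH_le (hP : P.Valid) (hg : ∀ t < P.T, ‖g t‖ ≤ G)
    (hB : CorruptionBounded P.T P.k G g gt) {t : ℕ} (ht : t ≤ P.T) :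
    runH P gt t ≤ 4 * P.capG G :=
  filter_h_le (F := fun t => (run P gt t).filter) hP.τG (run_filter_zero P gt)
    (run_filter_succ P gt) hg hB.1 ht

theorem runDoublings_le (hP : P.Valid) (hg : ∀ t < P.T, ‖g t‖ ≤ G)
    (hB : CorruptionBounded P.T P.k G g gt) :
    runDoublings P gt ≤ 2 * Real.log (4 * (P.capG G / P.τG)) := by
  have h1 := filter_h_eq (F := fun t => (run P gt t).filter) hP.τG (run_filter_zero P gt)
    (run_filter_succ P gt) P.T
  have h2 := Real.log_le_log (runH_pos gt hP P.T) (runH_le hP hg hB le_rfl)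
  have hM : 0 < P.capG G := hP.τG.trans_le (le_max_left _ _)
  have hD := runDoublings_nonneg (P := P) (gt := gt)
  rw [← mul_div_assoc, Real.log_div (by positivity) hP.τG.ne']
  have h3 : runDoublings P gt * Real.log 2 = Real.log (runH P gt P.T) - Real.log P.τG := by
    unfold runDoublings runH
    linarith
  nlinarith [Real.log_two_gt_d9]

theorem sum_sq_runV_le (hP : P.Valid) (hg : ∀ t < P.T, ‖g t‖ ≤ G)
    (hB : CorruptionBounded P.T P.k G g gt) :
    √(∑ t ∈ Finset.range P.T, ‖runV P gt t‖ ^ 2) ≤ 15 * P.capG G * √P.T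
      + 3 * (P.c * P.p) * (1 + P.p * Real.log (1 + 1 / P.α * runTotal P gt)) := by
  set M := P.capG G with hMdef
  set H := 1 + P.p * Real.log (1 + 1 / P.α * runTotal P gt) with hH
  have hM : 0 < M := hP.τG.trans_le (le_max_left _ _)
  have hp : 0 < P.p := by linarith [hP.one_lt_p]
  have hcp : 0 < P.c * P.p := mul_pos hP.c hp
  have hα := hP.α_pos
  have hH1 : 1 ≤ H := by
    have h5 : 0 ≤ Real.log (1 + 1 / P.α * runTotal P gt) := Real.log_nonneg (by
      have := runTotal_pos gt hP
      have : 0 ≤ 1 / P.α * runTotal P gt := by positivity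
      linarith)
    have : 0 ≤ P.p * Real.log (1 + 1 / P.α * runTotal P gt) := by positivity
    linarith
  have hround : ∀ t ∈ Finset.range P.T,
      ‖runV P gt t‖ ^ 2 ≤ 200 * M ^ 2 + 2 * (P.c * P.p) ^ 2 * runR P gt t := by
    intro t ht
    have h1 := norm_runV_le gt hP t
    have h2 := runH_le hP hg hB (Finset.mem_range.1 ht).le
    have h3 := runR_nonneg gt hP t
    have h4 := runR_le_one gt hP t
    have h5 : ‖runV P gt t‖ ≤ 10 * M + P.c * P.p * runR P gt t := by linarith
    have h6 := pow_le_pow_left₀ (norm_nonneg _) h5 2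
    have h7 : runR P gt t ^ 2 ≤ runR P gt t := by nlinarith
    have h8 := mul_le_mul_of_nonneg_left h7 (by positivity : 0 ≤ 2 * (P.c * P.p) ^ 2)
    nlinarith [sq_nonneg (10 * M - P.c * P.p * runR P gt t)]
  have hsum : ∑ t ∈ Finset.range P.T, ‖runV P gt t‖ ^ 2
      ≤ 200 * M ^ 2 * P.T + 6 * (P.c * P.p) ^ 2 * H := by
    refine (Finset.sum_le_sum hround).trans ?_
    rw [Finset.sum_add_distrib, Finset.sum_const, Finset.card_range, nsmul_eq_mul,
      ← Finset.mul_sum]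
    have := mul_le_mul_of_nonneg_left (sum_runR_le gt hP)
      (by positivity : 0 ≤ 2 * (P.c * P.p) ^ 2)
    linarith
  rw [Real.sqrt_le_left (by positivity)]
  refine hsum.trans ?_
  have hT : √(P.T : ℝ) ^ 2 = P.T := Real.sq_sqrt (Nat.cast_nonneg _)
  have hHH : H ≤ H ^ 2 := by nlinarith
  have h9 := mul_le_mul_of_nonneg_left hHH (by positivity : 0 ≤ (P.c * P.p) ^ 2)
  have h10 : 0 ≤ M * √P.T * (P.c * P.p) * H := by positivity
  have h11 : 0 ≤ M ^ 2 * (P.T : ℝ) := by positivity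
  have h12 : 0 ≤ (P.c * P.p) ^ 2 * H ^ 2 := by positivity
  have e : (15 * M * √P.T + 3 * (P.c * P.p) * H) ^ 2 = 225 * (M ^ 2 * √P.T ^ 2)
      + 90 * (M * √P.T * (P.c * P.p) * H) + 9 * ((P.c * P.p) ^ 2 * H ^ 2) := by
    ring
  rw [e, hT]
  linarith

/-- The loss caused by clipping and corruption, up to the quadratic penalties: the rounds that
change the threshold are paid for by `α_t`, all others by the last change of the tracker. -/
theorem corruption_le (hP : P.Valid) (hg : ∀ t < P.T, ‖g t‖ ≤ G)
    (hB : CorruptionBounded P.T P.k G g gt) (u : Vec d) {E : ℝ}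
    (hE : 9 * P.capG G * P.k * (runDoublings P gt + 1) ≤ E) :
    ∑ t ∈ Finset.range P.T, inner ℝ (g t - runClip P gt t) (runPlay P gt t - u)
      ≤ ∑ t ∈ Finset.range P.T, runWeight P gt t * ‖runPlay P gt t‖ ^ 2
        + E * P.τD + E ^ 2 / P.γβ * (1 + runChanges P gt) + E * ‖u‖
        + 3 * P.capG G * runDoublings P gt * ‖u‖
        + runDoublings P gt * (9 * P.capG G ^ 2 / (4 * P.γα)) := by
  set M := P.capG G with hMdef
  have hM : 0 < M := hP.τG.trans_le (le_max_left _ _)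
  set F := fun t => (run P gt t).filter with hF
  set K := fun t => (run P gt t).tracker with hK
  obtain ⟨e, he0, hesum, he⟩ := exists_clip_error (F := F) hP.k hP.τG (run_filter_zero P gt)
    (run_filter_succ P gt) hg hB
  have heE : ∑ t ∈ Finset.range P.T, e t ≤ E := hesum.trans hE
  have hE0 : 0 ≤ E := (Finset.sum_nonneg fun t _ => he0 t).trans heE
  have hz := norm_le_tracker (K := K) hP.τD (run_tracker_zero P gt) (run_tracker_succ P gt) P.T
  have hz0 := tracker_z_pos (K := K) hP.τD (run_tracker_zero P gt) (run_tracker_succ P gt) P.T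
  have htr := mul_tracker_le (K := K) hP.γβ hP.τD (run_tracker_zero P gt)
    (run_tracker_succ P gt) P.T hE0
  have hγα := hP.γα
  have hround : ∀ t ∈ Finset.range P.T, inner ℝ (g t - runClip P gt t) (runPlay P gt t - u)
      ≤ e t * ((K P.T).z + ‖u‖) + doubled F t * (3 * M * ‖u‖ + 9 * M ^ 2 / (4 * P.γα))
        + P.γα * doubled F t * ‖runPlay P gt t‖ ^ 2 := by
    intro t ht
    have ht' := Finset.mem_range.1 ht
    have h1 : ‖g t - runClip P gt t‖ ≤ e t + 3 * M * doubled F t := he t ht'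
    have h2 := hz t ht'
    have hd := doubled_nonneg F t
    have h3 : 3 * M * ‖runPlay P gt t‖
        ≤ 9 * M ^ 2 / (4 * P.γα) + P.γα * ‖runPlay P gt t‖ ^ 2 := by
      have e1 : 9 * M ^ 2 / (4 * P.γα) + P.γα * ‖runPlay P gt t‖ ^ 2 - 3 * M * ‖runPlay P gt t‖
          = (3 * M - 2 * P.γα * ‖runPlay P gt t‖) ^ 2 / (4 * P.γα) := by
        field_simp; ring
      have : 0 ≤ (3 * M - 2 * P.γα * ‖runPlay P gt t‖) ^ 2 / (4 * P.γα) := by positivity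
      linarith
    calc inner ℝ (g t - runClip P gt t) (runPlay P gt t - u)
        ≤ ‖g t - runClip P gt t‖ * ‖runPlay P gt t - u‖ := real_inner_le_norm _ _
      _ ≤ (e t + 3 * M * doubled F t) * (‖runPlay P gt t‖ + ‖u‖) :=
          mul_le_mul h1 (norm_sub_le _ _) (norm_nonneg _)
            (add_nonneg (he0 t) (by positivity))
      _ = e t * (‖runPlay P gt t‖ + ‖u‖) + doubled F t * (3 * M * ‖u‖)
          + doubled F t * (3 * M * ‖runPlay P gt t‖) := by ring
      _ ≤ e t * ((K P.T).z + ‖u‖) + doubled F t * (3 * M * ‖u‖)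
          + doubled F t * (9 * M ^ 2 / (4 * P.γα) + P.γα * ‖runPlay P gt t‖ ^ 2) := by
        have := mul_le_mul_of_nonneg_left h2 (he0 t)
        have := mul_le_mul_of_nonneg_left h3 hd
        linarith
      _ = _ := by ring
  refine (Finset.sum_le_sum hround).trans ?_
  rw [Finset.sum_add_distrib, Finset.sum_add_distrib, ← Finset.sum_mul, ← Finset.sum_mul]
  have hA : ∑ t ∈ Finset.range P.T, runWeight P gt t * ‖runPlay P gt t‖ ^ 2
      = ∑ t ∈ Finset.range P.T, P.γα * doubled F t * ‖runPlay P gt t‖ ^ 2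
        + ∑ t ∈ Finset.range P.T, betaWeight P.γβ (K t) (K (t + 1)) * ‖runPlay P gt t‖ ^ 2 := by
    rw [← Finset.sum_add_distrib]
    refine Finset.sum_congr rfl fun t _ => ?_
    rw [runWeight_eq]; ring
  rw [hA]
  have h4 := mul_le_mul_of_nonneg_right heE (by positivity : 0 ≤ (K P.T).z + ‖u‖)
  have hD : ∑ t ∈ Finset.range P.T, doubled F t = runDoublings P gt := rfl
  have hm : ((K P.T).m : ℝ) = runChanges P gt := rfl
  rw [hD]
  rw [hm] at htr
  linarith

/-- Regret on the clipped gradients. -/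
theorem clipped_regret_le (hP : P.Valid) (hg : ∀ t < P.T, ‖g t‖ ≤ G)
    (hB : CorruptionBounded P.T P.k G g gt) (u : Vec d) {b Λ : ℝ}
    (hb : 12 * P.capG G + P.c * P.p ≤ b) (hΛ0 : 0 ≤ Λ)
    (hΛ1 : 1 + Real.log (1 + ‖u‖ * P.T * b / (P.ε * P.τG))
      + 5 / 4 * Real.log (1 + 4 * P.T * b ^ 2 / slopeBound P P.τG ^ 2) ≤ Λ)
    (hΛ2 : 1 + Real.log (1 + ‖u‖ ^ 2 * P.T * (3 * P.γ) / (P.ε * P.τG))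
      + 5 / 4 * Real.log (1 + 4 * P.T * (3 * P.γ) ^ 2 / (3 * P.γ) ^ 2) ≤ Λ) :
    ∑ t ∈ Finset.range P.T, inner ℝ (runClip P gt t) (runPlay P gt t - u)
        + P.c * (runTotal P gt - P.α)
        + ∑ t ∈ Finset.range P.T, runWeight P gt t * ‖runPlay P gt t‖ ^ 2
      ≤ 2 * (P.ε * P.τG)
        + ‖u‖ * ((3 + 2 * √Λ) * √(∑ t ∈ Finset.range P.T, ‖runV P gt t‖ ^ 2) + 2 * b * Λ)
        + ‖u‖ ^ 2 * (2 * runWeightSum P gt + 16 * P.γ * Λ)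
        + P.c * P.p * ‖u‖ * ∑ t ∈ Finset.range P.T, runR P gt t := by
  have hM : 0 < P.capG G := hP.τG.trans_le (le_max_left _ _)
  have hcp : 0 < P.c * P.p := mul_pos hP.c (by linarith [hP.one_lt_p])
  have hW : 0 < P.ε * P.τG := mul_pos hP.ε hP.τG
  have hBle : ∀ t ≤ P.T, slopeBound P (runH P gt t) ≤ b := fun t ht => by
    have := runH_le hP hg hB ht
    unfold slopeBound
    linarith
  have hmag := magnitude_direction_regret (sm := fun t => (runBase P gt t).mag)
    (sd := fun t => (runBase P gt t).dir) (v := runV P gt)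
    (B := fun t => slopeBound P (runH P gt t)) hW (slopeBound_pos gt hP) rfl rfl
    (norm_runV_le_slopeBound gt hP) (runBase_mag_succ P gt) (runBase_dir_succ P gt) (T := P.T) u
    (by linarith) (hBle 0 (Nat.zero_le _)) (fun t ht => hBle t ht.le) hΛ1 hΛ0
  have hext := extra_regret (s := fun t => (runBase P gt t).extra) hW hP.γ_pos rfl
    (runWeight_nonneg gt hP) (runWeight_le gt hP) (runN_nonneg gt hP) (runN_le gt hP)
    (runBase_extra_succ P gt) (T := P.T) (sq_nonneg ‖u‖) hΛ2 hΛ0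
  have hsum := Finset.sum_le_sum fun t (_ : t ∈ Finset.range P.T) => run_round_le gt hP t u
  simp only [Finset.sum_add_distrib, ← Finset.mul_sum, ← Finset.sum_mul] at hsum
  have hN := mul_le_mul_of_nonneg_left (runTotal_sub_le gt hP) hP.c.le
  have hmag' : ∑ t ∈ Finset.range P.T, inner ℝ (runV P gt t) ((runPoint P gt t).1 - u) ≤ _ := hmag
  have hext' : ∑ t ∈ Finset.range P.T,
      (runWeight P gt t - runN P gt t) * ((runPoint P gt t).2 - ‖u‖ ^ 2) ≤ _ := hext
  unfold runWeightSum
  linarith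

end Assembly

/-! ### Estimates of the logarithms -/

/-- The argument of the logarithm in `logFactor`. -/
def logBase {d : ℕ} (P : Params) (G : ℝ) (u : Vec d) : ℝ :=
  Real.exp 1 + P.T + P.k + P.capG G / P.τG + ‖u‖ / P.ε
    + P.c / P.τG + P.τG / P.c + P.τD / P.ε + P.ε / P.τD
    + P.γα * P.ε / P.τG + P.τG / (P.γα * P.ε)
    + P.γβ * P.ε / P.τG + P.τG / (P.γβ * P.ε)

theorem log_one_add_le_mul_log {X y : ℝ} (n : ℕ) (hX : 2 ≤ X) (hy0 : 0 ≤ y) (hy : y ≤ X ^ n) :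
    Real.log (1 + y) ≤ (n + 1) * Real.log X := by
  have h1 : (1 : ℝ) ≤ X ^ n := one_le_pow₀ (by linarith)
  have h2 : 1 + y ≤ X ^ (n + 1) := by
    rw [pow_succ]; nlinarith
  have h3 := Real.log_le_log (by linarith) h2
  rw [Real.log_pow] at h3
  exact_mod_cast h3

section Logs

variable {d : ℕ} {P : Params} (G : ℝ) (u : Vec d)

theorem logBase_bounds (hP : P.Valid) :
    27 / 10 ≤ logBase P G u ∧ (P.T : ℝ) ≤ logBase P G u ∧ P.k ≤ logBase P G u ∧
      P.capG G / P.τG ≤ logBase P G u ∧ ‖u‖ / P.ε ≤ logBase P G u ∧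
      P.c / P.τG ≤ logBase P G u ∧ P.τG / P.c ≤ logBase P G u ∧
      P.ε / P.τD ≤ logBase P G u ∧ P.γα * P.ε / P.τG ≤ logBase P G u ∧
      P.γβ * P.ε / P.τG ≤ logBase P G u ∧ P.τG / (P.γβ * P.ε) ≤ logBase P G u := by
  obtain ⟨hT, hk, hε, hc, hγα, hγβ, hτG, hτD⟩ := hP
  have hM : 0 < P.capG G := hτG.trans_le (le_max_left _ _)
  have h1 : 0 ≤ P.capG G / P.τG := by positivity
  have h2 : 0 ≤ ‖u‖ / P.ε := by positivity
  have h3 : 0 ≤ P.c / P.τG := by positivity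
  have h4 : 0 ≤ P.τG / P.c := by positivity
  have h5 : 0 ≤ P.τD / P.ε := by positivity
  have h6 : 0 ≤ P.ε / P.τD := by positivity
  have h7 : 0 ≤ P.γα * P.ε / P.τG := by positivity
  have h8 : 0 ≤ P.τG / (P.γα * P.ε) := by positivity
  have h9 : 0 ≤ P.γβ * P.ε / P.τG := by positivity
  have h10 : 0 ≤ P.τG / (P.γβ * P.ε) := by positivity
  have h11 : (0 : ℝ) ≤ P.T := Nat.cast_nonneg _
  have h12 := Real.exp_one_gt_d9
  unfold logBase
  refine ⟨?_, ?_, ?_, ?_, ?_, ?_, ?_, ?_, ?_, ?_, ?_⟩ <;> linarith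

theorem one_le_logFactor (hP : P.Valid) : 1 ≤ logFactor P G u := by
  have h := logBase_bounds G u hP
  obtain ⟨hT, hk, hε, hc, hγα, hγβ, hτG, hτD⟩ := hP
  have hM : 0 < P.capG G := hτG.trans_le (le_max_left _ _)
  change 1 ≤ Real.log (logBase P G u)
  rw [Real.le_log_iff_exp_le (by linarith [h.1])]
  unfold logBase
  have : 0 ≤ (P.T : ℝ) + P.k + P.capG G / P.τG + ‖u‖ / P.ε
    + P.c / P.τG + P.τG / P.c + P.τD / P.ε + P.ε / P.τD
    + P.γα * P.ε / P.τG + P.τG / (P.γα * P.ε)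
    + P.γβ * P.ε / P.τG + P.τG / (P.γβ * P.ε) := by positivity
  linarith

theorem p_le_logFactor (hP : P.Valid) : P.p ≤ logFactor P G u := by
  have h := logBase_bounds G u hP
  have hT : 0 < P.T := by linarith [hP.T]
  exact Real.log_le_log (by exact_mod_cast hT) h.2.1

theorem logFactor_le_logBase (hP : P.Valid) : logFactor P G u ≤ logBase P G u := by
  have h := logBase_bounds G u hP
  have := Real.log_le_sub_one_of_pos (show 0 < logBase P G u by linarith [h.1])
  change Real.log (logBase P G u) ≤ _
  linarith

theorem log_magnitude_le (hP : P.Valid) :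
    1 + Real.log (1 + ‖u‖ * P.T * (12 * P.capG G + P.c * P.p) / (P.ε * P.τG))
      + 5 / 4 * Real.log (1 + 4 * P.T * (12 * P.capG G + P.c * P.p) ^ 2
        / slopeBound P P.τG ^ 2) ≤ 27 * logFactor P G u := by
  obtain ⟨hX, xT, xk, xM, xu, xc, -, -, -, -, -⟩ := logBase_bounds G u hP
  have hL1 := one_le_logFactor G u hP
  have hpX := (p_le_logFactor G u hP).trans (logFactor_le_logBase G u hP)
  have hp : 0 < P.p := by linarith [hP.one_lt_p]
  have hLX : logFactor P G u = Real.log (logBase P G u) := rfl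
  set X := logBase P G u
  obtain ⟨hT, hk, hε, hc, hγα, hγβ, hτG, hτD⟩ := hP
  have hM : 0 < P.capG G := hτG.trans_le (le_max_left _ _)
  have hX2 : 2 ≤ X := by linarith
  have hX0 : 0 < X := by linarith
  have hX3 : 12 ≤ X ^ 3 :=
    le_trans (by norm_num) (pow_le_pow_left₀ (by norm_num) hX 3)
  have hratio : (12 * P.capG G + P.c * P.p) / P.τG ≤ X ^ 5 := by
    have e : (12 * P.capG G + P.c * P.p) / P.τG
        = 12 * (P.capG G / P.τG) + P.c / P.τG * P.p := by field_simp
    rw [e]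
    have h1 : 12 * (P.capG G / P.τG) ≤ X ^ 3 * X := by gcongr
    have h2 : P.c / P.τG * P.p ≤ X * X := by gcongr
    have h3 : X * X ≤ X ^ 3 * X := by nlinarith
    have h4 : X ^ 5 = X ^ 3 * X * X := by ring
    have h5 : 0 ≤ X ^ 3 * X := by positivity
    rw [h4]
    nlinarith
  have h1 : ‖u‖ * P.T * (12 * P.capG G + P.c * P.p) / (P.ε * P.τG) ≤ X ^ 7 := by
    have e : ‖u‖ * P.T * (12 * P.capG G + P.c * P.p) / (P.ε * P.τG)
        = ‖u‖ / P.ε * P.T * ((12 * P.capG G + P.c * P.p) / P.τG) := by field_simp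
    rw [e]
    calc _ ≤ X * X * X ^ 5 := by gcongr
      _ = X ^ 7 := by ring
  have h2 : 4 * P.T * (12 * P.capG G + P.c * P.p) ^ 2 / slopeBound P P.τG ^ 2 ≤ X ^ 13 := by
    have hs : P.τG ≤ slopeBound P P.τG := by
      have : 0 < P.c * P.p := by positivity
      unfold slopeBound
      linarith
    have h3 : 4 ≤ X ^ 2 := by nlinarith
    calc 4 * P.T * (12 * P.capG G + P.c * P.p) ^ 2 / slopeBound P P.τG ^ 2
        ≤ 4 * P.T * (12 * P.capG G + P.c * P.p) ^ 2 / P.τG ^ 2 := by gcongr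
      _ = 4 * P.T * ((12 * P.capG G + P.c * P.p) / P.τG) ^ 2 := by ring
      _ ≤ X ^ 2 * X * (X ^ 5) ^ 2 := by gcongr
      _ = X ^ 13 := by ring
  have l1 := log_one_add_le_mul_log 7 hX2 (by positivity) h1
  have l2 := log_one_add_le_mul_log 13 hX2 (by positivity) h2
  rw [← hLX] at l1 l2
  push_cast at l1 l2
  linarith

theorem log_extra_le (hP : P.Valid) :
    1 + Real.log (1 + ‖u‖ ^ 2 * P.T * (3 * P.γ) / (P.ε * P.τG))
      + 5 / 4 * Real.log (1 + 4 * P.T * (3 * P.γ) ^ 2 / (3 * P.γ) ^ 2)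
        ≤ 27 * logFactor P G u := by
  obtain ⟨hX, xT, xk, xM, xu, -, -, -, xα, xβ, -⟩ := logBase_bounds G u hP
  have hL1 := one_le_logFactor G u hP
  have hLX : logFactor P G u = Real.log (logBase P G u) := rfl
  have hγ := hP.γ_pos
  set X := logBase P G u
  obtain ⟨hT, hk, hε, hc, hγα, hγβ, hτG, hτD⟩ := hP
  have hX2 : 2 ≤ X := by linarith
  have hX0 : 0 < X := by linarith
  have h1 : ‖u‖ ^ 2 * P.T * (3 * P.γ) / (P.ε * P.τG) ≤ X ^ 7 := by
    have e : ‖u‖ ^ 2 * P.T * (3 * P.γ) / (P.ε * P.τG)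
        = (‖u‖ / P.ε) ^ 2 * P.T * (3 * (P.γα * P.ε / P.τG + P.γβ * P.ε / P.τG)) := by
      rw [Params.γ]; field_simp
    rw [e]
    calc _ ≤ X ^ 2 * X * (3 * (X + X)) := by gcongr
      _ = X ^ 4 * 6 := by ring
      _ ≤ X ^ 4 * X ^ 3 := by
        gcongr
        exact le_trans (by norm_num) (pow_le_pow_left₀ (by norm_num) hX 3)
      _ = X ^ 7 := by ring
  have h2 : 4 * P.T * (3 * P.γ) ^ 2 / (3 * P.γ) ^ 2 ≤ X ^ 3 := by
    rw [mul_div_cancel_right₀ _ (by positivity)]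
    calc 4 * (P.T : ℝ) ≤ X ^ 2 * X := by gcongr; nlinarith
      _ = X ^ 3 := by ring
  have l1 := log_one_add_le_mul_log 7 hX2 (by positivity) h1
  have l2 := log_one_add_le_mul_log 3 hX2 (by positivity) h2
  rw [← hLX] at l1 l2
  push_cast at l1 l2
  linarith

theorem log_one_add_T_le (hP : P.Valid) :
    Real.log (1 + P.T) ≤ 2 * logFactor P G u := by
  obtain ⟨hX, xT, -⟩ := logBase_bounds G u hP
  have := log_one_add_le_mul_log (X := logBase P G u) 1 (by linarith) (Nat.cast_nonneg P.T)
    (by simpa using xT)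
  norm_num at this
  exact this

theorem log_doublings_le (hP : P.Valid) :
    Real.log (4 * (P.capG G / P.τG)) ≤ 3 * logFactor P G u := by
  obtain ⟨hX, -, -, xM, -⟩ := logBase_bounds G u hP
  have hM : 0 < P.capG G := hP.τG.trans_le (le_max_left _ _)
  have hτ := hP.τG
  have hX0 : 0 < logBase P G u := by linarith
  have h1 : 4 * (P.capG G / P.τG) ≤ logBase P G u ^ 3 := by
    calc 4 * (P.capG G / P.τG) ≤ logBase P G u ^ 2 * logBase P G u := by gcongr; nlinarith
      _ = _ := by ring
  have h2 := Real.log_le_log (by positivity) h1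
  rw [Real.log_pow] at h2
  exact_mod_cast h2

theorem log_absorb_comparator_le (hP : P.Valid) :
    Real.log (1 + 4 * (P.c * (174 * logFactor P G u ^ 3 * ‖u‖)) * (1 / P.α) / P.c)
      ≤ 13 * logFactor P G u := by
  obtain ⟨hX, -, -, -, xu, xc, -⟩ := logBase_bounds G u hP
  have hL1 := one_le_logFactor G u hP
  have hLle := logFactor_le_logBase G u hP
  have hα := hP.α_pos
  have hLX : Real.log (logBase P G u) = logFactor P G u := rfl
  set L := logFactor P G u
  set X := logBase P G u
  obtain ⟨hT, hk, hε, hc, hγα, hγβ, hτG, hτD⟩ := hP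
  have hX0 : 0 < X := by linarith
  have h1 : 4 * (P.c * (174 * L ^ 3 * ‖u‖)) * (1 / P.α) / P.c ≤ X ^ 12 := by
    have e : 4 * (P.c * (174 * L ^ 3 * ‖u‖)) * (1 / P.α) / P.c
        = 696 * L ^ 3 * (‖u‖ / P.ε) * (P.c / P.τG) := by
      rw [Params.α]; field_simp; ring
    rw [e]
    calc _ ≤ X ^ 7 * X ^ 3 * X * X := by
          gcongr
          exact le_trans (by norm_num) (pow_le_pow_left₀ (by norm_num) hX 7)
      _ = X ^ 12 := by ring
  have := log_one_add_le_mul_log 12 (by linarith) (by positivity) h1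
  rw [hLX] at this
  push_cast at this
  linarith

theorem log_absorb_tracker_le (hP : P.Valid) :
    Real.log (1 + 4 * (2 * (63 * logFactor P G u * P.capG G * P.k) ^ 2 / P.γβ)
      * (2 / P.τD) / P.c) ≤ 22 * logFactor P G u := by
  obtain ⟨hX, -, xk, xM, -, -, xc, xD, -, -, xβ⟩ := logBase_bounds G u hP
  have hL1 := one_le_logFactor G u hP
  have hLle := logFactor_le_logBase G u hP
  have hLX : Real.log (logBase P G u) = logFactor P G u := rfl
  set L := logFactor P G u
  set X := logBase P G u
  obtain ⟨hT, hk, hε, hc, hγα, hγβ, hτG, hτD⟩ := hP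
  have hM : 0 < P.capG G := hτG.trans_le (le_max_left _ _)
  have hX0 : 0 < X := by linarith
  have h1 : 4 * (2 * (63 * L * P.capG G * P.k) ^ 2 / P.γβ) * (2 / P.τD) / P.c ≤ X ^ 21 := by
    have e : 4 * (2 * (63 * L * P.capG G * P.k) ^ 2 / P.γβ) * (2 / P.τD) / P.c
        = 63504 * L ^ 2 * P.k ^ 2 * (P.capG G / P.τG) ^ 2 * (P.τG / (P.γβ * P.ε))
          * (P.τG / P.c) * (P.ε / P.τD) := by
      field_simp; ring
    rw [e]
    calc _ ≤ X ^ 12 * X ^ 2 * X ^ 2 * X ^ 2 * X * X * X := by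
          gcongr
          exact le_trans (by norm_num) (pow_le_pow_left₀ (by norm_num) hX 12)
      _ = X ^ 21 := by ring
  have := log_one_add_le_mul_log 21 (by linarith) (by positivity) h1
  rw [hLX] at this
  push_cast at this
  linarith

end Logs

/-! ### The regret bound -/

section Final

variable {d : ℕ} {P : Params} {gt : ℕ → Vec d} {G : ℝ} {g : ℕ → Vec d}

/-- The regret bound in which the size `N` of the plays still occurs: in `log (1 + N / α)`, in the
number of changes of the tracker, and in the negative term `-c (N - α)`. -/
theorem linRegret_le_raw (hP : P.Valid) (hg : ∀ t < P.T, ‖g t‖ ≤ G)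
    (hB : CorruptionBounded P.T P.k G g gt) (u : Vec d) {L : ℝ} (hL : L = logFactor P G u) :
    linRegret P.T g (runPlay P gt) u ≤ 2 * (P.ε * P.τG)
      + ‖u‖ * (57 * L * (15 * P.capG G * √P.T
          + 3 * P.c * L ^ 2 * (1 + Real.log (1 + 1 / P.α * runTotal P gt)))
        + 54 * L * (12 * P.capG G + P.c * L))
      + 444 * L * P.γ * ‖u‖ ^ 2
      + 3 * P.c * L ^ 2 * ‖u‖ * (1 + Real.log (1 + 1 / P.α * runTotal P gt))
      + 63 * L * P.capG G * P.k * P.τD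
      + (63 * L * P.capG G * P.k) ^ 2 / P.γβ * (1 + runChanges P gt)
      + 63 * L * P.capG G * P.k * ‖u‖ + 18 * L * P.capG G * ‖u‖
      + 14 * L * (P.capG G ^ 2 / P.γα)
      - P.c * (runTotal P gt - P.α) := by
  have hL1 : 1 ≤ L := hL ▸ one_le_logFactor G u hP
  have hpL : P.p ≤ L := hL ▸ p_le_logFactor G u hP
  have hp : 1 < P.p := hP.one_lt_p
  have hlog1 := hL ▸ log_magnitude_le G u hP
  have hlog2 := hL ▸ log_extra_le G u hP
  have hlogT := hL ▸ log_one_add_T_le G u hP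
  have hlogD := hL ▸ log_doublings_le G u hP
  have hM : 0 < P.capG G := hP.τG.trans_le (le_max_left _ _)
  have hα := hP.α_pos
  have hγ := hP.γ_pos
  have hN := runTotal_pos gt hP
  have hD0 := runDoublings_nonneg (P := P) (gt := gt)
  have hD : runDoublings P gt ≤ 6 * L := (runDoublings_le hP hg hB).trans (by linarith)
  have hA := runWeightSum_le (gt := gt) hP
  have hsq := sum_sq_runV_le hP hg hB
  have hR := sum_runR_le gt hP
  have hR0 := Finset.sum_nonneg fun t (_ : t ∈ Finset.range P.T) => runR_nonneg gt hP t
  have hclip := clipped_regret_le hP hg hB u (b := 12 * P.capG G + P.c * P.p) (Λ := 27 * L)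
    le_rfl (by linarith) hlog1 hlog2
  -- the threshold changes at most `6 L` times, and `9 [G] k (6 L + 1) ≤ 63 L [G] k`
  have hcor := corruption_le hP hg hB u (E := 63 * L * P.capG G * P.k) (by
    have h1 : runDoublings P gt + 1 ≤ 7 * L := by linarith
    have h2 := hP.k
    calc 9 * P.capG G * P.k * (runDoublings P gt + 1) ≤ 9 * P.capG G * P.k * (7 * L) := by gcongr
      _ = _ := by ring)
  obtain ⟨-, hk, hε, hc, hγα, hγβ, hτG, hτD⟩ := hP
  have hlin : linRegret P.T g (runPlay P gt) u
      = ∑ t ∈ Finset.range P.T, inner ℝ (runClip P gt t) (runPlay P gt t - u)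
        + ∑ t ∈ Finset.range P.T, inner ℝ (g t - runClip P gt t) (runPlay P gt t - u) := by
    rw [linRegret, ← Finset.sum_add_distrib]
    refine Finset.sum_congr rfl fun t _ => ?_
    rw [← inner_add_left]
    congr 1
    abel
  have hH : 0 ≤ Real.log (1 + 1 / P.α * runTotal P gt) := Real.log_nonneg (by
    have : 0 ≤ 1 / P.α * runTotal P gt := by positivity
    linarith)
  set H := Real.log (1 + 1 / P.α * runTotal P gt)
  set M := P.capG G
  set U := ‖u‖
  have hU : 0 ≤ U := norm_nonneg u
  have hpH : 1 + P.p * H ≤ L * (1 + H) := by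
    linarith only [mul_le_mul_of_nonneg_right hpL hH, hL1]
  have hsqrtΛ : √(27 * L) ≤ 27 * L := by
    rw [Real.sqrt_le_left (by linarith)]
    exact le_self_pow₀ (by linarith) two_ne_zero
  have hSQ : √(∑ t ∈ Finset.range P.T, ‖runV P gt t‖ ^ 2)
      ≤ 15 * M * √P.T + 3 * P.c * L ^ 2 * (1 + H) := by
    refine hsq.trans ?_
    have : 3 * (P.c * P.p) * (1 + P.p * H) ≤ 3 * (P.c * L) * (L * (1 + H)) := by gcongr
    linarith
  have t1 : U * ((3 + 2 * √(27 * L)) * √(∑ t ∈ Finset.range P.T, ‖runV P gt t‖ ^ 2)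
        + 2 * (12 * M + P.c * P.p) * (27 * L))
      ≤ U * (57 * L * (15 * M * √P.T + 3 * P.c * L ^ 2 * (1 + H))
        + 54 * L * (12 * M + P.c * L)) := by
    have h1 : 3 + 2 * √(27 * L) ≤ 57 * L := by linarith
    have h2 : 2 * (12 * M + P.c * P.p) * (27 * L) ≤ 54 * L * (12 * M + P.c * L) := by
      have : P.c * P.p * L ≤ P.c * L * L := by gcongr
      linarith
    exact mul_le_mul_of_nonneg_left (add_le_add
      (mul_le_mul h1 hSQ (Real.sqrt_nonneg _) (by positivity)) h2) hU
  have hAγ : runWeightSum P gt ≤ 6 * L * P.γ := by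
    have h1 : P.γα * runDoublings P gt ≤ P.γα * (6 * L) := by gcongr
    have h2 : P.γβ * Real.log (1 + P.T) ≤ P.γβ * (2 * L) := by gcongr
    have h3 : 0 ≤ P.γβ * L := by positivity
    have e : 6 * L * P.γ = P.γα * (6 * L) + 6 * (P.γβ * L) := by rw [Params.γ]; ring
    rw [e]
    linarith
  have t3 : U ^ 2 * (2 * runWeightSum P gt + 16 * P.γ * (27 * L)) ≤ 444 * L * P.γ * U ^ 2 := by
    have h1 : U ^ 2 * (2 * runWeightSum P gt + 16 * P.γ * (27 * L))
        ≤ U ^ 2 * (2 * (6 * L * P.γ) + 16 * P.γ * (27 * L)) := by gcongr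
    linarith
  have t4 : P.c * P.p * U * ∑ t ∈ Finset.range P.T, runR P gt t
      ≤ 3 * P.c * L ^ 2 * U * (1 + H) := by
    have h1 : P.c * P.p * U ≤ P.c * L * U := by gcongr
    have h2 : P.c * L * U * (3 * (L * (1 + H))) = 3 * P.c * L ^ 2 * U * (1 + H) := by ring
    rw [← h2]
    exact mul_le_mul h1 (hR.trans (by linarith only [hpH])) hR0 (by positivity)
  have t5 : 3 * M * runDoublings P gt * U ≤ 18 * L * M * U := by
    have : 3 * M * runDoublings P gt * U ≤ 3 * M * (6 * L) * U := by gcongr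
    linarith
  have t6 : runDoublings P gt * (9 * M ^ 2 / (4 * P.γα)) ≤ 14 * L * (M ^ 2 / P.γα) := by
    have h1 : runDoublings P gt * (9 * M ^ 2 / (4 * P.γα)) ≤ 6 * L * (9 * M ^ 2 / (4 * P.γα)) := by
      gcongr
    have h2 : 6 * L * (9 * M ^ 2 / (4 * P.γα)) = 27 / 2 * (L * (M ^ 2 / P.γα)) := by
      field_simp; ring
    have h3 : 0 ≤ L * (M ^ 2 / P.γα) := by positivity
    linarith
  rw [hlin]
  linarith only [hclip, hcor, t1, t3, t4, t5, t6]

theorem linRegret_le (hP : P.Valid) (hg : ∀ t < P.T, ‖g t‖ ≤ G)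
    (hB : CorruptionBounded P.T P.k G g gt) (u : Vec d) :
    linRegret P.T g (runPlay P gt) u ≤ 200000 * logFactor P G u ^ 4 * rate P G u := by
  have hraw := linRegret_le_raw hP hg hB u rfl
  have hL1 := one_le_logFactor G u hP
  have habs1 := log_absorb_comparator_le G u hP
  have habs2 := log_absorb_tracker_le G u hP
  have hα := hP.α_pos
  have hN := runTotal_pos gt hP
  have hm := tracker_m_le (K := fun t => (run P gt t).tracker) hP.τD
    (run_tracker_zero P gt) (run_tracker_succ P gt) hN.le
    (fun t ht => norm_play_le_runTotal gt hP ht)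
  change runChanges P gt ≤ _ at hm
  set L := logFactor P G u
  set N := runTotal P gt
  set H := Real.log (1 + 1 / P.α * N)
  have hγdef : P.γ = P.γα + P.γβ := rfl
  have hcα : P.c * P.α = P.ε * P.τG := by
    have := hP.c.ne'
    rw [Params.α]; field_simp
  have hτM : P.τG ≤ P.capG G := le_max_left _ _
  obtain ⟨hT, hk, hε, hc, hγα, hγβ, hτG, hτD⟩ := hP
  have hM : 0 < P.capG G := hτG.trans_le hτM
  rw [rate]
  set M := P.capG G
  have hU : 0 ≤ ‖u‖ := norm_nonneg u
  set U := ‖u‖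
  have hs1 : 1 ≤ √(P.T : ℝ) := by
    rw [Real.one_le_sqrt]
    exact_mod_cast (by omega : 1 ≤ P.T)
  set s := √(P.T : ℝ)
  -- the logarithms of the size of the plays are absorbed by the regularizer
  have ha1 := mul_log_le_absorb (A := P.c * (174 * L ^ 3 * U)) (x := 1 / P.α) (by positivity)
    (by positivity) hN.le hc
  have ha1' : P.c * (174 * L ^ 3 * U) * Real.log (1 + 4 * (P.c * (174 * L ^ 3 * U))
      * (1 / P.α) / P.c) ≤ P.c * (174 * L ^ 3 * U) * (13 * L) := by gcongr
  have ha2 := mul_log_le_absorb (A := 2 * (63 * L * M * P.k) ^ 2 / P.γβ) (x := 2 / P.τD)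
    (by positivity) (by positivity) hN.le hc
  have ha2' : 2 * (63 * L * M * P.k) ^ 2 / P.γβ * Real.log (1 + 4 * (2 * (63 * L * M * P.k) ^ 2
      / P.γβ) * (2 / P.τD) / P.c) ≤ 2 * (63 * L * M * P.k) ^ 2 / P.γβ * (22 * L) := by gcongr
  have hm' : (63 * L * M * P.k) ^ 2 / P.γβ * runChanges P gt
      ≤ (63 * L * M * P.k) ^ 2 / P.γβ * (2 * Real.log (1 + 2 / P.τD * N)) := by gcongr
  have hH0 : 0 ≤ H := Real.log_nonneg (by
    have : 0 ≤ 1 / P.α * N := by positivity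
    linarith)
  have l1 : L ≤ L ^ 4 := le_self_pow₀ hL1 (by norm_num)
  have l2 : L ^ 2 ≤ L ^ 4 := pow_le_pow_right₀ hL1 (by norm_num)
  have l3 : L ^ 3 ≤ L ^ 4 := pow_le_pow_right₀ hL1 (by norm_num)
  have l0 : 1 ≤ L ^ 4 := hL1.trans l1
  have hHterm : U * (57 * L * (3 * P.c * L ^ 2 * (1 + H))) + 3 * P.c * L ^ 2 * U * (1 + H)
      ≤ P.c * (174 * L ^ 3 * U) + P.c * (174 * L ^ 3 * U) * H := by
    have : 3 * P.c * L ^ 2 * U * (1 + H) ≤ 3 * P.c * L ^ 3 * U * (1 + H) := by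
      gcongr
      norm_num
    linarith
  -- every term is at most a constant times `L ^ 4` times a term of `rate`
  have hcN : 0 ≤ P.c * N := by positivity
  have b1 : P.ε * P.τG ≤ L ^ 4 * (P.ε * M) := by
    calc P.ε * P.τG ≤ 1 * (P.ε * M) := by rw [one_mul]; gcongr
      _ ≤ _ := by gcongr
  have b2 : L * (U * M * s) ≤ L ^ 4 * (U * M * s) := by gcongr
  have b3 : L * (U * M) ≤ L ^ 4 * (U * M * s) := by
    calc L * (U * M) ≤ L * (U * M * s) := mul_le_mul_of_nonneg_left
          (le_mul_of_one_le_right (by positivity) hs1) (by linarith)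
      _ ≤ _ := b2
  have b4 : L ^ 2 * (P.c * U) ≤ L ^ 4 * (P.c * U) := by gcongr
  have b5 : L ^ 3 * (P.c * U) ≤ L ^ 4 * (P.c * U) := by gcongr
  have b6 : L * (P.γ * U ^ 2) ≤ L ^ 4 * ((P.γα * (P.k + 1) + P.γβ) * U ^ 2) := by
    have : P.γ ≤ P.γα * (P.k + 1) + P.γβ := by
      have : 0 ≤ P.γα * P.k := by positivity
      rw [hγdef]; linarith
    exact mul_le_mul l1 (mul_le_mul_of_nonneg_right this (sq_nonneg U))
      (mul_nonneg (by rw [hγdef]; positivity) (sq_nonneg U)) (by positivity)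
  have b7 : L * (P.k * P.τD * M) ≤ L ^ 4 * (P.k * P.τD * M) := by gcongr
  have b8 : L ^ 2 * (P.k ^ 2 * M ^ 2 / P.γβ) ≤ L ^ 4 * (P.k ^ 2 * M ^ 2 / P.γβ) := by gcongr
  have b9 : L ^ 3 * (P.k ^ 2 * M ^ 2 / P.γβ) ≤ L ^ 4 * (P.k ^ 2 * M ^ 2 / P.γβ) := by gcongr
  have b10 : L * (U * M * P.k) ≤ L ^ 4 * (U * M * P.k) := by gcongr
  have b11 : L * (M ^ 2 / P.γα) ≤ L ^ 4 * ((P.k + 1) * M ^ 2 / P.γα) := by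
    have : M ^ 2 / P.γα ≤ (P.k + 1) * M ^ 2 / P.γα := by
      gcongr
      exact le_mul_of_one_le_left (sq_nonneg M) (by linarith)
    gcongr
  have e1 : (63 * L * M * P.k) ^ 2 / P.γβ = 3969 * (L ^ 2 * (P.k ^ 2 * M ^ 2 / P.γβ)) := by ring
  have e2 : 2 * (63 * L * M * P.k) ^ 2 / P.γβ * (22 * L)
      = 174636 * (L ^ 3 * (P.k ^ 2 * M ^ 2 / P.γβ)) := by ring
  have e3 : 2 * (63 * L * M * P.k) ^ 2 / P.γβ * Real.log (1 + 2 / P.τD * N)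
      = (63 * L * M * P.k) ^ 2 / P.γβ * (2 * Real.log (1 + 2 / P.τD * N)) := by ring
  have z1 : 0 ≤ L ^ 4 * (P.ε * M) := by positivity
  have z2 : 0 ≤ L ^ 4 * (U * M * s) := by positivity
  have z3 : 0 ≤ L ^ 4 * (P.c * U) := by positivity
  have z4 : 0 ≤ L ^ 4 * (P.c * P.τD) := by positivity
  have z5 : 0 ≤ L ^ 4 * ((P.γα * (P.k + 1) + P.γβ) * U ^ 2) := by positivity
  have z6 : 0 ≤ L ^ 4 * (P.k * P.τD * M) := by positivity
  have z7 : 0 ≤ L ^ 4 * (P.k ^ 2 * M ^ 2 / P.γβ) := by positivity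
  have z8 : 0 ≤ L ^ 4 * (U * M * P.k) := by positivity
  have z9 : 0 ≤ L ^ 4 * ((P.k + 1) * M ^ 2 / P.γα) := by positivity
  have hup : linRegret P.T g (runPlay P gt) u ≤ 3 * (P.ε * P.τG) + 855 * (L * (U * M * s))
      + 666 * (L * (U * M)) + 54 * (L ^ 2 * (P.c * U)) + 174 * (L ^ 3 * (P.c * U))
      + 2262 * (L ^ 4 * (P.c * U)) + 444 * (L * (P.γ * U ^ 2)) + 63 * (L * (P.k * P.τD * M))
      + 3969 * (L ^ 2 * (P.k ^ 2 * M ^ 2 / P.γβ)) + 174636 * (L ^ 3 * (P.k ^ 2 * M ^ 2 / P.γβ))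
      + 63 * (L * (U * M * P.k)) + 14 * (L * (M ^ 2 / P.γα)) := by
    change _ * H ≤ _ at ha1
    linarith only [hraw, hcα, ha1, ha1', ha2, ha2', hm', hHterm, hcN, e1, e2, e3]
  refine hup.trans ?_
  have e4 : 200000 * L ^ 4 * (P.ε * M + P.k * P.τD * M + U * M * (s + P.k) + P.c * (U + P.τD)
      + (P.γα * (P.k + 1) + P.γβ) * U ^ 2 + (P.k + 1) * M ^ 2 / P.γα + P.k ^ 2 * M ^ 2 / P.γβ)
      = 200000 * (L ^ 4 * (P.ε * M) + L ^ 4 * (P.k * P.τD * M) + L ^ 4 * (U * M * s)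
      + L ^ 4 * (U * M * P.k) + L ^ 4 * (P.c * U) + L ^ 4 * (P.c * P.τD)
      + L ^ 4 * ((P.γα * (P.k + 1) + P.γβ) * U ^ 2) + L ^ 4 * ((P.k + 1) * M ^ 2 / P.γα)
      + L ^ 4 * (P.k ^ 2 * M ^ 2 / P.γβ)) := by ring
  rw [e4]
  linarith only [b1, b2, b3, b4, b5, b6, b7, b8, b9, b10, b11, z1, z2, z3, z4, z5, z6, z7, z8, z9]

end Final

theorem regret_le_linRegret {d : ℕ} {T : ℕ} {ℓ : ℕ → Vec d → ℝ} {g w : ℕ → Vec d}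
    (h : ∀ t < T, IsSubgradient (ℓ t) (w t) (g t)) (u : Vec d) :
    regret T ℓ w u ≤ linRegret T g w u := by
  refine Finset.sum_le_sum fun t ht => ?_
  have := h t (Finset.mem_range.1 ht) u
  rw [← neg_sub (w t) u, inner_neg_right] at this
  linarith

end RobustOCO

end

theorem mainTheorem1 :
    ∃ (C : ℝ) (m : ℕ), 0 < C ∧
      ∀ (d : ℕ) (P : RobustOCO.Params),
        3 ≤ P.T → 0 ≤ P.k → 0 < P.ε → 0 < P.c → 0 < P.γα → 0 < P.γβ → 0 < P.τG → 0 < P.τD →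
      ∀ (G : ℝ) (g gt : ℕ → RobustOCO.Vec d),
        (∀ t < P.T, ‖g t‖ ≤ G) →
        RobustOCO.CorruptionBounded P.T P.k G g gt →
      ∀ u : RobustOCO.Vec d,
        RobustOCO.linRegret P.T g (RobustOCO.play P (RobustOCO.epigraphAlgorithm d P) gt) u
            ≤ C * RobustOCO.logFactor P G u ^ m * RobustOCO.rate P G u ∧
        ∀ ℓ : ℕ → RobustOCO.Vec d → ℝ,
          (∀ t < P.T, RobustOCO.IsSubgradient (ℓ t)
            (RobustOCO.play P (RobustOCO.epigraphAlgorithm d P) gt t) (g t)) →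
          RobustOCO.regret P.T ℓ (RobustOCO.play P (RobustOCO.epigraphAlgorithm d P) gt) u
            ≤ C * RobustOCO.logFactor P G u ^ m * RobustOCO.rate P G u := by
  refine ⟨200000, 4, by norm_num, ?_⟩
  intro d P hT hk hε hc hγα hγβ hτG hτD G g gt hg hB u
  have h := RobustOCO.linRegret_le (gt := gt) ⟨hT, hk, hε, hc, hγα, hγβ, hτG, hτD⟩ hg hB u
  exact ⟨h, fun ℓ hℓ => (RobustOCO.regret_le_linRegret hℓ u).trans h⟩
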